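/- Let $V$ be a finite set with $|V|=n+1$, let $T=\{\lambda\in\mathbb R_{\ge 0}^V:\sum_{i\in V}\lambda_i=1\}$ be the standard simplex with vertex set $V$, with interior $\mathring T$, and let $0\le k\le n$. The blow-up $\tilde T$ of $T$ is the set of all families $(\lambda_i^K)$ of nonnegative reals, indexed by the nonempty $K\subseteq V$ and $i\in K$, such that $\sum_{i\in K}\lambda^K_i=1$ for all $K$ and $\lambda_i^H=\big(\sum_{i'\in K}\lambda_{i'}^H\big)\lambda_i^K$ whenever $i\in K\subseteq H$. The map $\pi:\tilde T\to T$, $\lambda_i=\lambda_i^V$, is a diffeomorphism over $\mathring T$, with inverse $\lambda_i^K=\lambda_i/\sum_{i'\in K}\lambda_{i'}$. Let $F=(V_0,\dots,V_{n-k})$ be a flag, that is, an ordered partition of $V$ into $n-k+1$ nonempty sets. The face of $\tilde T$ corresponding to $F$ is the set $\tilde T_F$ of the points of $\tilde T$ with $\lambda_{i'}^{\{i,i'\}}=0$ for all $i\in V_j$, $i'\in V_{j'}$ with $j<j'$. Let $\Theta=\prod_j T_{V_j}=\{\theta\in\mathbb R^V_{\ge0}:\sum_{i\in V_j}\theta_i=1\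 \forall j\}$, where $T_{V_j}$ is the standard simplex with vertex set $V_j$, let $\mathring\Theta$ be its interior, and let $R=\{\rho\in\mathbb R_{\ge0}^{n-k+1}:\sum_j\rho_j=1\}$. Give $\Theta$ an orientation (for $k=0$, when $\Theta$ is a point, the positive one), and orient $\tilde T_F$ by means of the map $\theta_i=\lambda_i^{V_j}$ ($i\in V_j$), which identifies the interior of $\tilde T_F$ with $\mathring\Theta$. For a $k$-form $\psi$ on $\mathring T$ and $\rho\in\mathring R$, let $\psi_\rho$ be the pullback of $\psi$ to $\mathring\Theta$ under $\theta\mapsto\lambda$, $\lambda_i=\rho_j\theta_i$ for $i\in V_j$. The degree of freedom $\Psi_F$ is $$\Psi_F(\psi)=\int_\Theta\lim_{\rho_1\to0}\cdots\lim_{\rho_{n-k}\to0}\psi_\rho ,$$ where the iterated limit is taken pointwise on $\mathring\Theta$, each single limit $\rho_s\to0$ being a limit from the interior of the face $\rho_{s+1}=\dots=\rho_{n-k}=0$ of $R$ to the points of the interior of the face $\rho_s=\dots=\rho_{n-k}=0$. Let $\tilde\psi$ be a $k$-form on $\tilde T$ that is smooth up to and including the boundary, and let $\psi=(\pi^{-1})^*\tilde\psi$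 be the corresponding $k$-form on $\mathring T$. Then the limits defining $\Psi_F(\psi)$ exist, the limit form is integrable over $\Theta$, $\tilde\psi$ is integrable over $\tilde T_F$, and $$\Psi_F(\psi)=\int_{\tilde T_F}\tilde\psi .$$ -/

import Mathlib

open Set Filter Topology MeasureTheory
open scoped ContDiff

noncomputable section

set_option linter.unusedSectionVars false

namespace BlowUp

/-! ## Differential forms on subsets of normed spaces, and their integrals -/

section Forms

variable {E E' : Type*} [NormedAddCommGroup E] [NormedSpace ℝ E]
  [NormedAddCommGroup E'] [NormedSpace ℝ E']

/-- The tangent space of a set `S` at `x`: the linear span of the tangent directions of `S` at `x`.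
For an embedded manifold with corners this is the usual (full) tangent space, also at the points of
the boundary. -/
def TangentSpan (S : Set E) (x : E) : Submodule ℝ E :=
  Submodule.span ℝ (tangentConeAt ℝ S x)

/-- A (not necessarily continuous) `k`-form on the set `S`: an alternating `k`-linear form on the
tangent space of `S` at each point of `S`. -/
abbrev FormOn (k : ℕ) (S : Set E) : Type _ :=
  ∀ x : S, TangentSpan S (x : E) [⋀^Fin k]→L[ℝ] ℝ

/-- A form on `S` is smooth (up to and including whatever boundary points belong to `S`) if near
each point of `S` it is the restriction of a smooth form on an open subset of the ambient space. -/
def SmoothForm {k : ℕ} {S : Set E} (α : FormOn k S) : Prop :=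
  ∀ x ∈ S, ∃ U : Set E, IsOpen U ∧ x ∈ U ∧ ∃ η : E → E [⋀^Fin k]→L[ℝ] ℝ,
    ContDiffOn ℝ ∞ η U ∧
      ∀ y : S, (y : E) ∈ U →
        α y = (η y).compContinuousLinearMap (TangentSpan S (y : E)).subtypeL

theorem fderivWithin_mem_tangentSpan {f : E → E'} {S : Set E} {S' : Set E'}
    (hf : DifferentiableOn ℝ f S) (hm : MapsTo f S S') {x : E} (hx : x ∈ S)
    {v : E} (hv : v ∈ TangentSpan S x) :
    fderivWithin ℝ f S x v ∈ TangentSpan S' (f x) := by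
  have h1 : MapsTo (fderivWithin ℝ f S x) (tangentConeAt ℝ S x) (tangentConeAt ℝ S' (f x)) :=
    fun w hw => tangentConeAt_mono hm.image_subset
      ((hf x hx).hasFDerivWithinAt.mapsTo_tangent_cone hw)
  have h2 : TangentSpan S x ≤ (TangentSpan S' (f x)).comap
      (fderivWithin ℝ f S x : E →ₗ[ℝ] E') :=
    Submodule.span_le.2 fun w hw => Submodule.subset_span (h1 hw)
  exact h2 hv

/-- The differential at `x ∈ S` of a map `f : S → S'`, as a map of tangent spaces. -/
def tangentMap (f : E → E') {S : Set E} {S' : Set E'}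
    (hf : DifferentiableOn ℝ f S) (hm : MapsTo f S S') (x : S) :
    TangentSpan S (x : E) →L[ℝ] TangentSpan S' (f x) :=
  ((fderivWithin ℝ f S x).comp (TangentSpan S (x : E)).subtypeL).codRestrict _
    fun v => fderivWithin_mem_tangentSpan hf hm x.2 v.2

/-- The pullback `f^* α` of a form along a differentiable map `f : S → S'`. -/
def FormOn.pullback {k : ℕ} (f : E → E') {S : Set E} {S' : Set E'}
    (hf : DifferentiableOn ℝ f S) (hm : MapsTo f S S') (α : FormOn k S') : FormOn k S :=
  fun x => (α ⟨f x, hm x.2⟩).compContinuousLinearMap (tangentMap f hf hm x)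

/-- The restriction of a form to a subset (the pullback along the inclusion). -/
def FormOn.restrict {k : ℕ} {S S' : Set E} (hS : S ⊆ S') (α : FormOn k S') : FormOn k S :=
  FormOn.pullback id differentiableOn_id (fun _ hx => hS hx) α

theorem mem_tangentSpan_of_isOpen {U : Set E} (hU : IsOpen U) {x : E} (hx : x ∈ U) (v : E) :
    v ∈ TangentSpan U x := by
  have h : tangentConeAt ℝ U x = univ := tangentConeAt_of_mem_nhds (hU.mem_nhds hx)
  exact Submodule.subset_span (h ▸ mem_univ v)

variable [MeasurableSpace E] [BorelSpace E]

/-- An oriented smooth parametrization of a `k`-dimensional set `S`, up to a subset of `S` of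
`k`-dimensional measure zero.  The orientation of `S` is given by the predicate `pos`, which says
when a `k`-tuple of tangent vectors is a positively oriented basis. -/
structure OrientedParam (k : ℕ) (S : Set E) (pos : (Fin k → E) → Prop) where
  dom : Set (Fin k → ℝ)
  isOpen : IsOpen dom
  toFun : (Fin k → ℝ) → E
  smooth : ContDiffOn ℝ ∞ toFun dom
  mapsTo : MapsTo toFun dom S
  injOn : InjOn toFun dom
  immersion : ∀ u ∈ dom, Function.Injective (fderiv ℝ toFun u)
  positive : ∀ u ∈ dom, pos fun a => fderiv ℝ toFun u (Pi.single a 1)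
  conull : μH[(k : ℝ)] (S \ toFun '' dom) = 0

open Classical in
/-- The coefficient `c` of the pulled back form `φ^* α = c du₁ ∧ ⋯ ∧ du_k`. -/
def OrientedParam.coeff {k : ℕ} {S : Set E} {pos : (Fin k → E) → Prop}
    (P : OrientedParam k S pos) (α : FormOn k S) (u : Fin k → ℝ) : ℝ :=
  if hu : u ∈ P.dom then
    (FormOn.pullback P.toFun (P.smooth.differentiableOn (by simp)) P.mapsTo α ⟨u, hu⟩)
      fun a => ⟨Pi.single a 1, mem_tangentSpan_of_isOpen P.isOpen hu _⟩
  else 0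

/-- The `k`-form `α` is (absolutely) integrable over the oriented `k`-dimensional set `S`, and
its integral is `a`. By the change of variables formula neither depends on the parametrization. -/
def HasFormIntegral {k : ℕ} (S : Set E) (pos : (Fin k → E) → Prop) (α : FormOn k S) (a : ℝ) :
    Prop :=
  ∃ P : OrientedParam k S pos, IntegrableOn (P.coeff α) P.dom ∧ ∫ u in P.dom, P.coeff α u = a

end Forms

/-! ## Simplex, flags and quasi-cylindrical coordinates -/

section Simplex

variable {V : Type*} [Fintype V] [DecidableEq V]

variable (V) in
/-- The interior of the standard barycentric simplex `T_V`. -/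
def openSimplex : Set (V → ℝ) := {l | (∀ i, 0 < l i) ∧ ∑ i, l i = 1}

variable (V) in
/-- A flag on `V` with `r + 1` parts: an ordered partition `(V₀, …, V_r)` of `V` into nonempty
sets, given by the map that sends `i ∈ V_j` to `j`. -/
structure Flag (r : ℕ) where
  idx : V → Fin (r + 1)
  surjective : Function.Surjective idx

variable {r : ℕ}

/-- The part `V_j` of a flag. -/
def Flag.part (F : Flag V r) (j : Fin (r + 1)) : Finset V := Finset.univ.filter fun i => F.idx i = j

/-- The interior of the angular space `Θ_F = ∏_j T_{V_j}`. -/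
def Flag.openAngular (F : Flag V r) : Set (V → ℝ) :=
  {θ | (∀ i, 0 < θ i) ∧ ∀ j, ∑ i ∈ F.part j, θ i = 1}

/-- The directions tangent to `Θ_F`. -/
def Flag.angularDir (F : Flag V r) : Submodule ℝ (V → ℝ) where
  carrier := {w | ∀ j, ∑ i ∈ F.part j, w i = 0}
  add_mem' := fun {v w} hv hw j => by
    simp only [Pi.add_apply, Finset.sum_add_distrib, hv j, hw j, add_zero]
  zero_mem' := fun j => by simp
  smul_mem' := fun c w hw j => by
    simp only [Pi.smul_apply, smul_eq_mul, ← Finset.mul_sum, hw j, mul_zero]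

/-- Positively oriented `k`-tuples of tangent vectors of `Θ_F`, when `Θ_F` carries the orientation
of the ordered basis `b`. -/
def Flag.AngularPos (F : Flag V r) {k : ℕ} (b : Module.Basis (Fin k) ℝ F.angularDir)
    (w : Fin k → V → ℝ) : Prop :=
  ∃ hw : ∀ a, w a ∈ F.angularDir, 0 < b.det fun a => (⟨w a, hw a⟩ : F.angularDir)

/-- The quasi-cylindrical coordinate map `λ_i = ρ_j θ_i` for `i ∈ V_j`. -/
def Flag.quasiCyl (F : Flag V r) (ρ : Fin (r + 1) → ℝ) (θ : V → ℝ) : V → ℝ :=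
  fun i => ρ (F.idx i) * θ i

theorem Flag.quasiCyl_mapsTo (F : Flag V r) {ρ : Fin (r + 1) → ℝ}
    (hρ : ρ ∈ openSimplex (Fin (r + 1))) :
    MapsTo (F.quasiCyl ρ) F.openAngular (openSimplex V) := by
  intro θ hθ
  refine ⟨fun i => mul_pos (hρ.1 _) (hθ.1 i), ?_⟩
  rw [← Finset.sum_fiberwise (s := Finset.univ) (g := F.idx), ← hρ.2]
  refine Finset.sum_congr rfl fun j _ => ?_
  calc ∑ i ∈ Finset.univ.filter (fun i => F.idx i = j), F.quasiCyl ρ θ i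
      = ∑ i ∈ F.part j, ρ j * θ i :=
        Finset.sum_congr rfl fun i hi => by simp [quasiCyl, (Finset.mem_filter.1 hi).2]
    _ = ρ j := by rw [← Finset.mul_sum, hθ.2 j, mul_one]

theorem Flag.quasiCyl_differentiable (F : Flag V r) (ρ : Fin (r + 1) → ℝ) :
    Differentiable ℝ (F.quasiCyl ρ) := by
  unfold quasiCyl
  fun_prop

/-- The form `ψ_ρ` on the interior of `Θ_F`, the pullback of `ψ` under `θ ↦ (ρ, θ)`. -/
def Flag.slice (F : Flag V r) {k : ℕ} (ψ : FormOn k (openSimplex V))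
    (ρ : openSimplex (Fin (r + 1))) : FormOn k F.openAngular :=
  FormOn.pullback (F.quasiCyl ρ) (F.quasiCyl_differentiable ρ).differentiableOn
    (F.quasiCyl_mapsTo ρ.2) ψ

/-- The interior of the face `ρ_{s+1} = ⋯ = ρ_r = 0` of the radial simplex `R_F`. -/
def radialFace (s : Fin (r + 1)) : Set (Fin (r + 1) → ℝ) :=
  {ρ | (∀ j ≤ s, 0 < ρ j) ∧ (∀ j, s < j → ρ j = 0) ∧ ∑ j, ρ j = 1}

/-- The iterated limit `lim_{ρ₁ → 0} ⋯ lim_{ρ_r → 0} g(ρ)` of a function `g` on the interior of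
the radial simplex exists and equals `L`. Here `G s` is the function on the interior of the face
`ρ_{s+1} = ⋯ = ρ_r = 0` that is obtained after the limits `ρ_r → 0, …, ρ_{s+1} → 0`; each single
limit `ρ_{s+1} → 0` is a limit from the interior of one face to a point in the interior of the
next. The last face is the single point `ρ₀ = 1`. -/
def HasIteratedLimit {W : Type*} [TopologicalSpace W] (g : openSimplex (Fin (r + 1)) → W)
    (L : W) : Prop :=
  ∃ G : Fin (r + 1) → (Fin (r + 1) → ℝ) → W,
    (∀ ρ : openSimplex (Fin (r + 1)), G (Fin.last r) ρ = g ρ) ∧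
    (∀ s : Fin r, ∀ ρ' ∈ radialFace s.castSucc,
      Tendsto (G s.succ) (𝓝[radialFace s.succ] ρ') (𝓝 (G s.castSucc ρ'))) ∧
    ∀ ρ ∈ radialFace (0 : Fin (r + 1)), G 0 ρ = L

/-- The degree of freedom `Ψ_F(ψ) = ∫_Θ lim_{ρ₁ → 0} ⋯ lim_{ρ_r → 0} ψ_ρ` is defined (the limits
exist pointwise on the interior of `Θ_F` and the limit form is integrable) and equals `a`. -/
def Flag.HasDegreeOfFreedom (F : Flag V r) {k : ℕ} (b : Module.Basis (Fin k) ℝ F.angularDir)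
    (ψ : FormOn k (openSimplex V)) (a : ℝ) : Prop :=
  ∃ L : FormOn k F.openAngular,
    (∀ θ, HasIteratedLimit (fun ρ => F.slice ψ ρ θ) (L θ)) ∧
      HasFormIntegral F.openAngular (F.AngularPos b) L a

/-! ## The blow-up of the simplex -/

variable (V) in
/-- The faces of `T_V`, given by their nonempty vertex sets. -/
abbrev Face : Type _ := {K : Finset V // K.Nonempty}

variable (V) in
/-- The space `∏_K ℝ^{V_K}` with coordinates `x K i = λ_i^K`. -/
abbrev Ambient : Type _ := ∀ K : Face V, K.1 → ℝ

variable (V) in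
/-- The blow-up `T̃` of the simplex `T_V`. -/
def blowUp : Set (Ambient V) :=
  {x | (∀ K i, 0 ≤ x K i) ∧ (∀ K, ∑ i, x K i = 1) ∧
    ∀ (K H : Face V) (h : K.1 ⊆ H.1) (i : K.1),
      x H ⟨i, h i.2⟩ = (∑ i' : K.1, x H ⟨i', h i'.2⟩) * x K i}

/-- The projection `π : T̃ → T`, `λ_i = λ_i^T`. -/
def proj (x : Ambient V) : V → ℝ :=
  fun i => x ⟨Finset.univ, i, Finset.mem_univ i⟩ ⟨i, Finset.mem_univ i⟩

/-- The inverse of `π` over the interior of `T`: `λ_i^K = λ_i / ∑_{i' ∈ K} λ_{i'}`. -/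
def lift (l : V → ℝ) : Ambient V := fun K i => l i / ∑ i' ∈ K.1, l i'

theorem sum_face_pos {l : V → ℝ} (hl : ∀ i, 0 < l i) (K : Face V) : 0 < ∑ i ∈ K.1, l i :=
  Finset.sum_pos (fun i _ => hl i) K.2

theorem lift_mapsTo : MapsTo (lift (V := V)) (openSimplex V) (blowUp V) := by
  intro l hl
  refine ⟨fun K i => (div_pos (hl.1 i) (sum_face_pos hl.1 K)).le, fun K => ?_, fun K H h i => ?_⟩
  · have := (sum_face_pos hl.1 K).ne'
    simp only [lift]
    rw [← Finset.sum_div, Finset.sum_coe_sort K.1 l, div_self this]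
  · have hK := (sum_face_pos hl.1 K).ne'
    simp only [lift]
    rw [← Finset.sum_div, Finset.sum_coe_sort K.1 l]
    field_simp

theorem lift_differentiableOn : DifferentiableOn ℝ (lift (V := V)) (openSimplex V) := by
  intro l hl
  refine DifferentiableAt.differentiableWithinAt ?_
  refine differentiableAt_pi.2 fun K => differentiableAt_pi.2 fun i => ?_
  have h1 : DifferentiableAt ℝ (fun l : V → ℝ => l i) l := by fun_prop
  have h2 : DifferentiableAt ℝ (fun l : V → ℝ => ∑ i' ∈ K.1, l i') l := by fun_prop
  simp only [lift, div_eq_mul_inv]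
  exact h1.fun_mul (h2.fun_inv (sum_face_pos hl.1 K).ne')

theorem proj_lift {l : V → ℝ} (hl : l ∈ openSimplex V) : proj (lift l) = l := by
  funext i
  simp [proj, lift, hl.2]

theorem lift_proj {x : Ambient V} (hx : x ∈ blowUp V) (hp : proj x ∈ openSimplex V) :
    lift (proj x) = x := by
  funext K i
  have h := hx.2.2 K ⟨Finset.univ, i, Finset.mem_univ _⟩ (Finset.subset_univ _) i
  have hs : ∑ i' : K.1, proj x i' = ∑ i' ∈ K.1, proj x i' := Finset.sum_coe_sort K.1 (proj x)
  have h' : proj x i = (∑ i' ∈ K.1, proj x i') * x K i := by rw [← hs]; exact h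
  simp only [lift]
  rw [h', mul_div_cancel_left₀ _ (sum_face_pos hp.1 K).ne']

/-- The form `ψ` on the interior of `T` that corresponds to a form `ψ̃` on `T̃`, the interiors
being identified by `π`: that is, `ψ = (π⁻¹)^* ψ̃`. -/
def pushToSimplex {k : ℕ} (ψt : FormOn k (blowUp V)) : FormOn k (openSimplex V) :=
  FormOn.pullback lift lift_differentiableOn lift_mapsTo ψt

/-- The edge `E_{ii'}` of `T`. -/
def edge (i i' : V) : Face V := ⟨{i, i'}, by simp⟩

/-- The face of `T̃` that corresponds to the flag `F`, given by the equations
`λ_{i'}^{E_{ii'}} = 0` for `i ∈ V_j`, `i' ∈ V_{j'}` and `j < j'`. -/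
def Flag.blowUpFace (F : Flag V r) : Set (Ambient V) :=
  {x | x ∈ blowUp V ∧ ∀ i i', F.idx i < F.idx i' → x (edge i i') ⟨i', by simp [edge]⟩ = 0}

theorem Flag.blowUpFace_subset (F : Flag V r) : F.blowUpFace ⊆ blowUp V := fun _ hx => hx.1

/-- The projection of the face onto `Θ_F`, `θ_i = λ_i^{T_j}` for `i ∈ V_j`. It identifies the
interiors of the two. -/
def Flag.toAngular (F : Flag V r) (x : Ambient V) : V → ℝ :=
  fun i => x ⟨F.part (F.idx i), i, by simp [part]⟩ ⟨i, by simp [part]⟩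

/-- Positively oriented `k`-tuples of tangent vectors of the face of `T̃`: those whose images under
the (linear) projection to `Θ_F` are positively oriented. -/
def Flag.FacePos (F : Flag V r) {k : ℕ} (b : Module.Basis (Fin k) ℝ F.angularDir)
    (w : Fin k → Ambient V) : Prop :=
  F.AngularPos b fun a => F.toAngular (w a)

end Simplex

end BlowUp

end

/-!
The whole face of the blow-up and the iterated limit are read off from one family of maps. For
weights `m` on the faces of the simplex, `quot m` sends `θ` to the point with coordinates
`λ_i^K = m_i^K θ_i / ∑_{i' ∈ K} m_{i'}^K θ_{i'}`. With the weights `Flag.radialWeight ρ`, which on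
each face `K` are `ρ` divided by its value on the first part of the flag that meets `K`, this map is
the lift to the blow-up of `θ ↦ (ρ_j θ_i)` when `ρ` is interior (`Flag.quot_radialWeight_eq_lift`),
and it makes sense on each of the faces `ρ_{s+1} = ⋯ = ρ_r = 0` as well. The weights depend
continuously on `ρ` along each single limit, even where `ρ_j / ρ_{j'}` turns into `0 / 0`
(`Flag.tendsto_radialWeight`). Since `quot` is smooth in `(m, θ)` and `ψ̃` is smooth up to the
boundary, the slices `ψ_ρ` converge; their iterated limit is the pullback of `ψ̃` along
`quot (leadWeight F.idx)` (`Flag.hasIteratedLimit_slice`), and this last map parametrizes the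
interior of the face of the blow-up, with `Flag.toAngular` as its inverse. In an affine chart of the
angular space the two integrals thus have the same integrand, `Flag.faceCoeff`.

Two points need an argument. First, the parametrization misses only a null set of the face. At a
point of the blow-up, "`λ_{i'}` is infinitely small compared with `λ_i`" is a strict weak order
(`exists_rank`), and the point lies in the image of `quot (leadWeight c)` for a rank function `c` of
this order (`exists_quot_leadWeight_eq`). A point of the face that is missed has an order that
properly refines the flag, and the corresponding image has dimension less than `k`.

Second, the integrand is integrable although the derivative of the parametrization is unbounded near
the boundary of the angular space. By compactness of the blow-up it is bounded by a multiple of the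
sum of the `k × k` minors of that derivative. Each minor is the Jacobian of a map into the unit cube
whose fibres are given by linear equations in `θ`; hence this map is injective where the minor does
not vanish, and the integral of the absolute value of the minor is at most `1`
(`Flag.integrableOn_det_coordDeriv`).
-/

noncomputable section

set_option linter.unusedSectionVars false

namespace BlowUp

/-! ### Evaluation of forms and pullbacks -/

section FormCalculus

variable {E E' : Type*} [NormedAddCommGroup E] [NormedSpace ℝ E]
  [NormedAddCommGroup E'] [NormedSpace ℝ E'] {k : ℕ} {S : Set E} {S' : Set E'}

theorem fderivWithin_eq_of_mem_tangentSpan {f : E → E'} {f' : E →L[ℝ] E'} {x v : E}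
    (h : HasFDerivWithinAt f f' S x) (hv : v ∈ TangentSpan S x) :
    fderivWithin ℝ f S x v = f' v := by
  have h1 : TangentSpan S x ≤ LinearMap.eqLocus
      (fderivWithin ℝ f S x : E →ₗ[ℝ] E') (f' : E →ₗ[ℝ] E') :=
    Submodule.span_le.2 fun w hw => h.differentiableWithinAt.hasFDerivWithinAt.unique_on h hw
  exact h1 hv

theorem hasFDerivWithinAt_mem_tangentSpan {f : E → E'} {f' : E →L[ℝ] E'} {x v : E}
    (h : HasFDerivWithinAt f f' S x) (hm : MapsTo f S S')
    (hv : v ∈ TangentSpan S x) : f' v ∈ TangentSpan S' (f x) := by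
  have h1 : TangentSpan S x ≤ (TangentSpan S' (f x)).comap (f' : E →ₗ[ℝ] E') :=
    Submodule.span_le.2 fun w hw =>
      Submodule.subset_span (tangentConeAt_mono hm.image_subset (h.mapsTo_tangent_cone hw))
  exact h1 hv

open Classical in
/-- The value of a form on `S` at arbitrary arguments: `α y w` where this makes sense, and `0` if
`y ∉ S` or some `w a` is not tangent to `S` at `y`. Unlike `α`, it takes arguments of a type that
does not depend on `y`, so that base points can be rewritten. -/
def FormOn.eval (α : FormOn k S) (y : E) (w : Fin k → E) : ℝ :=
  if h : y ∈ S ∧ ∀ a, w a ∈ TangentSpan S y then α ⟨y, h.1⟩ fun a => ⟨w a, h.2 a⟩ else 0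

theorem FormOn.eval_of_mem (α : FormOn k S) {y : E} {w : Fin k → E} (hy : y ∈ S)
    (hw : ∀ a, w a ∈ TangentSpan S y) : α.eval y w = α ⟨y, hy⟩ fun a => ⟨w a, hw a⟩ :=
  dif_pos ⟨hy, hw⟩

theorem FormOn.pullback_apply {f : E → E'} (hf : DifferentiableOn ℝ f S) (hm : MapsTo f S S')
    (α : FormOn k S') {x : S} {f' : E →L[ℝ] E'} (h : HasFDerivWithinAt f f' S x)
    (w : Fin k → TangentSpan S (x : E)) :
    FormOn.pullback f hf hm α x w = α.eval (f x) fun a => f' (w a) := by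
  rw [FormOn.eval_of_mem α (hm x.2) fun a => hasFDerivWithinAt_mem_tangentSpan h hm (w a).2]
  simp only [FormOn.pullback, ContinuousAlternatingMap.compContinuousLinearMap_apply]
  congr 1
  funext a
  exact Subtype.ext (fderivWithin_eq_of_mem_tangentSpan h (w a).2)

theorem FormOn.eval_pullback {f : E → E'} (hf : DifferentiableOn ℝ f S) (hm : MapsTo f S S')
    (α : FormOn k S') {x : E} (hx : x ∈ S) {f' : E →L[ℝ] E'} (h : HasFDerivWithinAt f f' S x)
    {w : Fin k → E} (hw : ∀ a, w a ∈ TangentSpan S x) :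
    (FormOn.pullback f hf hm α).eval x w = α.eval (f x) fun a => f' (w a) := by
  rw [FormOn.eval_of_mem _ hx hw, FormOn.pullback_apply hf hm α h]

theorem FormOn.eval_restrict {S₁ S₂ : Set E} (h : S₁ ⊆ S₂) (α : FormOn k S₂) {x : E}
    (hx : x ∈ S₁) {w : Fin k → E} (hw : ∀ a, w a ∈ TangentSpan S₁ x) :
    (α.restrict h).eval x w = α.eval x w :=
  FormOn.eval_pullback differentiableOn_id _ α hx (hasFDerivWithinAt_id x S₁) hw

theorem OrientedParam.coeff_eq [MeasurableSpace E] [BorelSpace E] {pos : (Fin k → E) → Prop}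
    (P : OrientedParam k S pos) (α : FormOn k S) {u : Fin k → ℝ} (hu : u ∈ P.dom)
    {f' : (Fin k → ℝ) →L[ℝ] E} (h : HasFDerivAt P.toFun f' u) :
    P.coeff α u = α.eval (P.toFun u) fun a => f' (Pi.single a 1) := by
  rw [OrientedParam.coeff, dif_pos hu]
  exact FormOn.pullback_apply (x := ⟨u, hu⟩) _ _ α h.hasFDerivWithinAt _

theorem OrientedParam.derivative_mem_tangentSpan [MeasurableSpace E] [BorelSpace E]
    {pos : (Fin k → E) → Prop} (P : OrientedParam k S pos) {u : Fin k → ℝ} (hu : u ∈ P.dom)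
    {f' : (Fin k → ℝ) →L[ℝ] E} (h : HasFDerivAt P.toFun f' u) (v : Fin k → ℝ) :
    f' v ∈ TangentSpan S (P.toFun u) :=
  hasFDerivWithinAt_mem_tangentSpan h.hasFDerivWithinAt P.mapsTo
    (mem_tangentSpan_of_isOpen P.isOpen hu v)

/-- Near each point of `S`, a smooth form on `S` is given by a continuous ambient form. -/
theorem SmoothForm.exists_eval_eq {α : FormOn k S} (hα : SmoothForm α) {x : E} (hx : x ∈ S) :
    ∃ U : Set E, IsOpen U ∧ x ∈ U ∧ ∃ η : E → E [⋀^Fin k]→L[ℝ] ℝ, ContinuousOn η U ∧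
      ∀ y ∈ S, y ∈ U → ∀ w : Fin k → E, (∀ a, w a ∈ TangentSpan S y) → α.eval y w = η y w := by
  obtain ⟨U, hU, hxU, η, hη, h⟩ := hα x hx
  refine ⟨U, hU, hxU, η, hη.continuousOn, fun y hy hyU w hw => ?_⟩
  rw [FormOn.eval_of_mem α hy hw, h ⟨y, hy⟩ hyU]
  rfl

/-- A smooth form on a compact set is bounded. -/
theorem SmoothForm.exists_bound {α : FormOn k S} (hα : SmoothForm α) (hS : IsCompact S) :
    ∃ C : ℝ, ∀ y ∈ S, ∃ η : E [⋀^Fin k]→L[ℝ] ℝ, ‖η‖ ≤ C ∧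
      ∀ w : Fin k → E, (∀ a, w a ∈ TangentSpan S y) → α.eval y w = η w := by
  refine hS.induction_on (p := fun A => ∃ C : ℝ, ∀ y ∈ A, ∃ η : E [⋀^Fin k]→L[ℝ] ℝ, ‖η‖ ≤ C ∧
      ∀ w : Fin k → E, (∀ a, w a ∈ TangentSpan S y) → α.eval y w = η w) ⟨0, by simp⟩ ?_ ?_ ?_
  · rintro A B hAB ⟨C, h⟩
    exact ⟨C, fun y hy => h y (hAB hy)⟩
  · rintro A B ⟨C, h⟩ ⟨D, h'⟩
    refine ⟨max C D, fun y hy => hy.elim (fun hy => ?_) fun hy => ?_⟩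
    · obtain ⟨η, h1, h2⟩ := h y hy
      exact ⟨η, h1.trans (le_max_left _ _), h2⟩
    · obtain ⟨η, h1, h2⟩ := h' y hy
      exact ⟨η, h1.trans (le_max_right _ _), h2⟩
  · intro x hx
    obtain ⟨U, hU, hxU, η, hη, h⟩ := hα.exists_eval_eq hx
    have hc : ContinuousAt η x := hη.continuousAt (hU.mem_nhds hxU)
    have h1 : ∀ᶠ y in 𝓝 x, ‖η y‖ < ‖η x‖ + 1 :=
      hc.norm.eventually (gt_mem_nhds (lt_add_one _))
    refine ⟨S ∩ {y | y ∈ U ∧ ‖η y‖ < ‖η x‖ + 1}, inter_mem self_mem_nhdsWithin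
      (mem_nhdsWithin_of_mem_nhds ((hU.eventually_mem hxU).and h1)), ‖η x‖ + 1, ?_⟩
    rintro y ⟨hyS, hyU, hy⟩
    exact ⟨η y, hy.le, h y hyS hyU⟩

end FormCalculus

/-! ### Alternating forms and minors -/

section Alternating

variable {ι : Type*} [Fintype ι] {k : ℕ}
  {E : Type*} [NormedAddCommGroup E] [NormedSpace ℝ E]

/-- The expansion of an alternating form in the minors of its arguments. Every set of `k`
basis vectors is counted once for each of its orderings, whence the factor `k!`. -/
theorem factorial_smul_alternatingMap_eq_sum_det (b : Module.Basis ι ℝ E)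
    (η : E [⋀^Fin k]→ₗ[ℝ] ℝ) (v : Fin k → E) :
    (k.factorial : ℝ) * η v = ∑ α : Fin k → ι,
      (Matrix.of fun a c => b.repr (v a) (α c)).det * η fun c => b (α c) := by
  have h1 : ∀ σ : Equiv.Perm (Fin k), ∑ α : Fin k → ι,
      ((Equiv.Perm.sign σ : ℤ) : ℝ) * (∏ c, b.repr (v (σ c)) (α c)) * η (fun c => b (α c))
        = η v := by
    intro σ
    have h2 : η (fun c => v (σ c)) = ∑ α : Fin k → ι,
        (∏ c, b.repr (v (σ c)) (α c)) * η fun c => b (α c) := by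
      conv_lhs => rw [show (fun c => v (σ c)) = fun c => ∑ i, b.repr (v (σ c)) i • b i from
        funext fun c => (b.sum_repr _).symm]
      have := η.toMultilinearMap.map_sum (α := fun _ => ι)
        (fun c i => b.repr (v (σ c)) i • b i)
      simp only [AlternatingMap.coe_multilinearMap] at this
      rw [this]
      refine Finset.sum_congr rfl fun α _ => ?_
      have := η.toMultilinearMap.map_smul_univ (fun c => b.repr (v (σ c)) (α c))
        (fun c => b (α c))
      simpa using this
    have h3 : η (fun c => v (σ c)) = ((Equiv.Perm.sign σ : ℤ) : ℝ) * η v := by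
      have := η.map_perm v σ
      rw [show (fun c => v (σ c)) = v ∘ σ from rfl, this, Units.smul_def, zsmul_eq_mul]
    simp only [mul_assoc]
    rw [← Finset.mul_sum, ← h2, h3, ← mul_assoc]
    have : ((Equiv.Perm.sign σ : ℤ) : ℝ) * ((Equiv.Perm.sign σ : ℤ) : ℝ) = 1 := by
      rw [← Int.cast_mul, ← Units.val_mul, Int.units_mul_self]; simp
    rw [this, one_mul]
  calc (k.factorial : ℝ) * η v = ∑ σ : Equiv.Perm (Fin k), η v := by
        simp [Fintype.card_perm]
    _ = ∑ σ : Equiv.Perm (Fin k), ∑ α : Fin k → ι, ((Equiv.Perm.sign σ : ℤ) : ℝ) *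
          (∏ c, b.repr (v (σ c)) (α c)) * η (fun c => b (α c)) :=
        Finset.sum_congr rfl fun σ _ => (h1 σ).symm
    _ = _ := by
        rw [Finset.sum_comm]
        refine Finset.sum_congr rfl fun α _ => ?_
        rw [← Finset.sum_mul, Matrix.det_apply']
        simp

/-- A bounded alternating form is controlled by the `k × k` minors of its arguments. -/
theorem abs_continuousAlternatingMap_le_sum_det (b : Module.Basis ι ℝ E) :
    ∃ B : ℝ, 0 ≤ B ∧ ∀ (η : E [⋀^Fin k]→L[ℝ] ℝ) (v : Fin k → E),
      |η v| ≤ B * ‖η‖ * ∑ α : Fin k → ι, |(Matrix.of fun a c => b.repr (v a) (α c)).det| := by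
  refine ⟨∑ α : Fin k → ι, ∏ c, ‖b (α c)‖, by positivity, fun η v => ?_⟩
  have h := factorial_smul_alternatingMap_eq_sum_det b η.toAlternatingMap v
  have hk : (1 : ℝ) ≤ k.factorial := by exact_mod_cast k.factorial_pos
  calc |η v| ≤ k.factorial * |η v| := le_mul_of_one_le_left (abs_nonneg _) hk
    _ = |(k.factorial : ℝ) * η v| := by rw [abs_mul, abs_of_nonneg (zero_le_one.trans hk)]
    _ = |∑ α : Fin k → ι, (Matrix.of fun a c => b.repr (v a) (α c)).det *
          η fun c => b (α c)| := congrArg _ h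
    _ ≤ ∑ α : Fin k → ι, |(Matrix.of fun a c => b.repr (v a) (α c)).det| *
          ((∑ α : Fin k → ι, ∏ c, ‖b (α c)‖) * ‖η‖) := by
        refine (Finset.abs_sum_le_sum_abs _ _).trans (Finset.sum_le_sum fun α _ => ?_)
        rw [abs_mul]
        gcongr
        calc |η fun c => b (α c)| ≤ ‖η‖ * ∏ c, ‖b (α c)‖ := η.le_opNorm _
          _ ≤ ‖η‖ * ∑ α : Fin k → ι, ∏ c, ‖b (α c)‖ := by
            gcongr
            exact Finset.single_le_sum (f := fun α : Fin k → ι => ∏ c, ‖b (α c)‖)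
              (fun _ _ => by positivity) (Finset.mem_univ α)
          _ = _ := mul_comm _ _
    _ = _ := by rw [← Finset.sum_mul]; ring

end Alternating

/-! ### The maps `quot m` into the blow-up -/

section Quot

variable {V : Type*} [Fintype V] [DecidableEq V]

/-- The sum `∑_{i ∈ K} m_i^K θ_i`. -/
def weightedSum (m : Ambient V) (θ : V → ℝ) (K : Face V) : ℝ := ∑ i : K.1, m K i * θ i

/-- The point with coordinates `λ_i^K = m_i^K θ_i / ∑_{i' ∈ K} m_{i'}^K θ_{i'}`. All maps into the
blow-up that are used here have this form, for various weights `m`. -/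
def quot (m : Ambient V) (θ : V → ℝ) : Ambient V := fun K i => m K i * θ i / weightedSum m θ K

theorem contDiffAt_quot {m : Ambient V} {θ : V → ℝ} (h : ∀ K, weightedSum m θ K ≠ 0)
    {n : WithTop ℕ∞} :
    ContDiffAt ℝ n (fun p : Ambient V × (V → ℝ) => quot p.1 p.2) (m, θ) := by
  refine contDiffAt_pi.2 fun K => contDiffAt_pi.2 fun i => ?_
  have h1 (i : K.1) : ContDiffAt ℝ n (fun p : Ambient V × (V → ℝ) => p.1 K i * p.2 i) (m, θ) :=
    (contDiffAt_pi.1 (contDiffAt_pi.1 contDiffAt_fst K) i).mul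
      (contDiffAt_pi.1 contDiffAt_snd (i : V))
  exact (h1 i).div (ContDiffAt.sum fun i _ => h1 i) (h K)

/-- The derivative of `quot m` at `θ`. -/
def quotDeriv (m : Ambient V) (θ : V → ℝ) : (V → ℝ) →L[ℝ] Ambient V :=
  (fderiv ℝ (fun p : Ambient V × (V → ℝ) => quot p.1 p.2) (m, θ)).comp
    (ContinuousLinearMap.inr ℝ _ _)

theorem hasFDerivAt_quot {m : Ambient V} {θ : V → ℝ} (h : ∀ K, weightedSum m θ K ≠ 0) :
    HasFDerivAt (quot m) (quotDeriv m θ) θ := by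
  have h1 := ((contDiffAt_quot h (n := 1)).differentiableAt (by simp)).hasFDerivAt
  exact h1.comp (f := fun θ => (m, θ)) θ (hasFDerivAt_prodMk_right m θ)

theorem continuousAt_quotDeriv {m : Ambient V} {θ : V → ℝ} (h : ∀ K, weightedSum m θ K ≠ 0) :
    ContinuousAt (fun p : Ambient V × (V → ℝ) => quotDeriv p.1 p.2) (m, θ) :=
  (((contDiffAt_quot h (n := 1)).fderiv_right (m := 0) (by simp)).continuousAt).clm_comp
    continuousAt_const

/-- The product rule for `λ_i^K · ∑_{i' ∈ K} m_{i'}^K θ_{i'} = m_i^K θ_i`. -/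
theorem quotDeriv_mul_weightedSum {m : Ambient V} {θ : V → ℝ} (h : ∀ K, weightedSum m θ K ≠ 0)
    (w : V → ℝ) (K : Face V) (i : K.1) :
    quotDeriv m θ w K i * weightedSum m θ K + quot m θ K i * weightedSum m w K = m K i * w i := by
  have hq : HasFDerivAt (fun θ => quot m θ K i)
      ((ContinuousLinearMap.proj i).comp ((ContinuousLinearMap.proj K).comp (quotDeriv m θ))) θ :=
    hasFDerivAt_pi'.1 (hasFDerivAt_pi'.1 (hasFDerivAt_quot h) K) i
  have hD : HasFDerivAt (fun θ => weightedSum m θ K)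
      (∑ i : K.1, m K i • (ContinuousLinearMap.proj (i : V) : (V → ℝ) →L[ℝ] ℝ)) θ := by
    unfold weightedSum
    exact HasFDerivAt.fun_sum fun i _ => (hasFDerivAt_apply (i : V) θ).const_mul (m K i)
  have hN : HasFDerivAt (fun θ : V → ℝ => m K i * θ i)
      (m K i • (ContinuousLinearMap.proj (i : V) : (V → ℝ) →L[ℝ] ℝ)) θ :=
    (hasFDerivAt_apply (i : V) θ).const_mul (m K i)
  have hev : (fun θ => quot m θ K i * weightedSum m θ K) =ᶠ[𝓝 θ] fun θ => m K i * θ i := by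
    filter_upwards [hD.continuousAt.eventually_ne (h K)] with t ht
    exact div_mul_cancel₀ _ ht
  have := (hq.mul hD).unique (hN.congr_of_eventuallyEq hev)
  have := DFunLike.congr_fun this w
  simp only [add_apply, smul_apply, sum_apply, ContinuousLinearMap.comp_apply, ContinuousLinearMap.proj_apply,
    smul_eq_mul] at this
  rw [weightedSum, weightedSum, ← this, weightedSum]
  ring

/-- Weights `m ≥ 0` of which, on each face, at least one is positive. -/
def IsWeight (m : Ambient V) : Prop := (∀ K i, 0 ≤ m K i) ∧ ∀ K, ∃ i, 0 < m K i

theorem IsWeight.weightedSum_pos {m : Ambient V} (hm : IsWeight m) {θ : V → ℝ}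
    (hθ : ∀ i, 0 < θ i) (K : Face V) : 0 < weightedSum m θ K := by
  obtain ⟨i, hi⟩ := hm.2 K
  exact Finset.sum_pos' (fun i _ => mul_nonneg (hm.1 K i) (hθ i).le)
    ⟨i, Finset.mem_univ _, mul_pos hi (hθ i)⟩

theorem IsWeight.weightedSum_ne_zero {m : Ambient V} (hm : IsWeight m) {θ : V → ℝ}
    (hθ : ∀ i, 0 < θ i) (K : Face V) : weightedSum m θ K ≠ 0 := (hm.weightedSum_pos hθ K).ne'

theorem IsWeight.quot_nonneg {m : Ambient V} (hm : IsWeight m) {θ : V → ℝ}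
    (hθ : ∀ i, 0 < θ i) (K : Face V) (i : K.1) : 0 ≤ quot m θ K i :=
  div_nonneg (mul_nonneg (hm.1 K i) (hθ i).le) (hm.weightedSum_pos hθ K).le

theorem IsWeight.sum_quot {m : Ambient V} (hm : IsWeight m) {θ : V → ℝ}
    (hθ : ∀ i, 0 < θ i) (K : Face V) : ∑ i, quot m θ K i = 1 := by
  simp only [quot]
  rw [← Finset.sum_div]
  exact div_self (hm.weightedSum_ne_zero hθ K)

/-- If the weights on each face are proportional to those on any larger face, then `quot m θ`
lies in the blow-up. -/
theorem IsWeight.quot_mem_blowUp {m : Ambient V} (hm : IsWeight m)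
    (hc : ∀ (K H : Face V) (h : K.1 ⊆ H.1), ∃ κ : ℝ, ∀ i : K.1, m H ⟨i, h i.2⟩ = κ * m K i)
    {θ : V → ℝ} (hθ : ∀ i, 0 < θ i) : quot m θ ∈ blowUp V := by
  refine ⟨hm.quot_nonneg hθ, hm.sum_quot hθ, fun K H h i => ?_⟩
  obtain ⟨κ, hκ⟩ := hc K H h
  have hK := hm.weightedSum_ne_zero hθ K
  have hH := hm.weightedSum_ne_zero hθ H
  have h1 : ∑ i' : K.1, quot m θ H ⟨i', h i'.2⟩ = κ * weightedSum m θ K / weightedSum m θ H := by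
    simp only [quot, hκ, mul_assoc]
    rw [← Finset.sum_div, ← Finset.mul_sum]
    rfl
  rw [h1]
  simp only [quot, hκ]
  field_simp

theorem isCompact_blowUp : IsCompact (blowUp V) := by
  refine Metric.isCompact_of_isClosed_isBounded ?_ ?_
  · simp only [blowUp, ofPred_and, ofPred_forall]
    refine IsClosed.inter ?_ (IsClosed.inter ?_ ?_)
    · exact isClosed_iInter fun K => isClosed_iInter fun i =>
        isClosed_le continuous_const (by fun_prop)
    · exact isClosed_iInter fun K => isClosed_eq (by fun_prop) continuous_const
    · exact isClosed_iInter fun K => isClosed_iInter fun H => isClosed_iInter fun h =>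
        isClosed_iInter fun i => isClosed_eq (by fun_prop) (by fun_prop)
  · refine (Metric.isBounded_Icc (0 : Ambient V) 1).subset fun x hx =>
      ⟨fun K i => hx.1 K i, fun K i => ?_⟩
    simp only [Pi.one_apply]
    rw [← hx.2.1 K]
    exact Finset.single_le_sum (fun i _ => hx.1 K i) (Finset.mem_univ i)

/-! ### Weights of a flag -/

/-- The weights that select, on each face, the vertices where `c` is smallest. -/
def leadWeight {ι : Type*} [LinearOrder ι] (c : V → ι) : Ambient V :=
  fun K i => if c i = K.1.inf' K.2 c then 1 else 0

theorem isWeight_leadWeight {ι : Type*} [LinearOrder ι] (c : V → ι) :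
    IsWeight (leadWeight c) := by
  refine ⟨fun K i => ?_, fun K => ?_⟩
  · unfold leadWeight; split_ifs <;> simp
  · obtain ⟨i, hi, h⟩ := K.1.exists_mem_eq_inf' K.2 c
    exact ⟨⟨i, hi⟩, by simp [leadWeight, h]⟩

variable {r : ℕ}

/-- The weights for which `quot` extends `θ ↦ lift (ρ_j θ_i)` to the boundary of the radial
simplex: on each face, `ρ` divided by its value on the first part that meets the face. If that
value is `0`, then so are the later ones (on the faces `radialFace s`), and the quotient `0 / 0 = 0`
is the correct weight. -/
def Flag.radialWeight (F : Flag V r) (ρ : Fin (r + 1) → ℝ) : Ambient V :=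
  fun K i => if F.idx i = K.1.inf' K.2 F.idx then 1 else ρ (F.idx i) / ρ (K.1.inf' K.2 F.idx)

theorem radialFace_nonneg {s : Fin (r + 1)} {ρ : Fin (r + 1) → ℝ} (hρ : ρ ∈ radialFace s)
    (j : Fin (r + 1)) : 0 ≤ ρ j := by
  rcases le_or_gt j s with h | h
  · exact (hρ.1 j h).le
  · exact (hρ.2.1 j h).ge

theorem Flag.isWeight_radialWeight (F : Flag V r) {ρ : Fin (r + 1) → ℝ} (hρ : ∀ j, 0 ≤ ρ j) :
    IsWeight (F.radialWeight ρ) := by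
  refine ⟨fun K i => ?_, fun K => ?_⟩
  · unfold Flag.radialWeight
    split_ifs
    · exact zero_le_one
    · exact div_nonneg (hρ _) (hρ _)
  · obtain ⟨i, hi, h⟩ := K.1.exists_mem_eq_inf' K.2 F.idx
    exact ⟨⟨i, hi⟩, by simp [Flag.radialWeight, h]⟩

theorem Flag.radialWeight_proportional (F : Flag V r) {s : Fin (r + 1)} {ρ : Fin (r + 1) → ℝ}
    (hρ : ρ ∈ radialFace s) (K H : Face V) (h : K.1 ⊆ H.1) :
    ∃ κ : ℝ, ∀ i : K.1, F.radialWeight ρ H ⟨i, h i.2⟩ = κ * F.radialWeight ρ K i := by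
  have hKH : H.1.inf' H.2 F.idx ≤ K.1.inf' K.2 F.idx := Finset.inf'_mono F.idx h K.2
  rcases hKH.eq_or_lt with heq | hlt
  · exact ⟨1, fun i => by simp [Flag.radialWeight, heq]⟩
  · refine ⟨ρ (K.1.inf' K.2 F.idx) / ρ (H.1.inf' H.2 F.idx), fun i => ?_⟩
    have hi : K.1.inf' K.2 F.idx ≤ F.idx i := Finset.inf'_le F.idx i.2
    simp only [Flag.radialWeight]
    rw [if_neg (hlt.trans_le hi).ne']
    rcases hi.eq_or_lt with hi | hi
    · rw [if_pos hi.symm, hi, mul_one]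
    · rw [if_neg hi.ne']
      by_cases hs : K.1.inf' K.2 F.idx ≤ s
      · have := (hρ.1 _ hs).ne'
        field_simp
      · rw [hρ.2.1 _ ((not_le.1 hs).trans hi), hρ.2.1 _ (not_le.1 hs)]
        simp

theorem Flag.quot_radialWeight_mapsTo (F : Flag V r) {s : Fin (r + 1)} {ρ : Fin (r + 1) → ℝ}
    (hρ : ρ ∈ radialFace s) : MapsTo (quot (F.radialWeight ρ)) F.openAngular (blowUp V) :=
  fun _ hθ => (F.isWeight_radialWeight (radialFace_nonneg hρ)).quot_mem_blowUp
    (F.radialWeight_proportional hρ) hθ.1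

theorem Flag.differentiableOn_quot (F : Flag V r) {m : Ambient V} (hm : IsWeight m) :
    DifferentiableOn ℝ (quot m) F.openAngular := fun _ hθ =>
  (hasFDerivAt_quot (hm.weightedSum_ne_zero hθ.1)).differentiableAt.differentiableWithinAt

theorem Flag.radialWeight_eq_leadWeight (F : Flag V r) {ρ : Fin (r + 1) → ℝ}
    (hρ : ρ ∈ radialFace (0 : Fin (r + 1))) : F.radialWeight ρ = leadWeight F.idx := by
  funext K i
  simp only [Flag.radialWeight, leadWeight]
  split_ifs with h
  · rfl
  · have hi : K.1.inf' K.2 F.idx ≤ F.idx i := Finset.inf'_le F.idx i.2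
    rw [hρ.2.1 _ ((Fin.zero_le _).trans_lt (hi.lt_of_ne' h)), zero_div]

/-- In the interior of the radial simplex, the weights give the lift of `λ_i = ρ_j θ_i`. -/
theorem Flag.quot_radialWeight_eq_lift (F : Flag V r) {ρ : Fin (r + 1) → ℝ}
    (hρ : ρ ∈ openSimplex (Fin (r + 1))) (θ : V → ℝ) :
    quot (F.radialWeight ρ) θ = lift (F.quasiCyl ρ θ) := by
  funext K i
  have hK := (hρ.1 (K.1.inf' K.2 F.idx)).ne'
  have h1 : ∀ i : K.1, F.radialWeight ρ K i * θ i
      = F.quasiCyl ρ θ i / ρ (K.1.inf' K.2 F.idx) := by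
    intro i
    simp only [Flag.radialWeight, Flag.quasiCyl]
    split_ifs with h
    · rw [← h] at hK ⊢
      field_simp
    · ring
  simp only [quot, weightedSum, lift, h1]
  rw [← Finset.sum_div, Finset.sum_coe_sort K.1 (F.quasiCyl ρ θ), div_div_div_cancel_right₀ hK]

theorem Flag.tendsto_radialWeight (F : Flag V r) (s : Fin r) {ρ' : Fin (r + 1) → ℝ}
    (hρ' : ρ' ∈ radialFace s.castSucc) :
    Tendsto F.radialWeight (𝓝[radialFace s.succ] ρ') (𝓝 (F.radialWeight ρ')) := by
  refine tendsto_pi_nhds.2 fun K => tendsto_pi_nhds.2 fun i => ?_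
  simp only [Flag.radialWeight]
  have hi : K.1.inf' K.2 F.idx ≤ F.idx i := Finset.inf'_le F.idx i.2
  split_ifs with h
  · exact tendsto_const_nhds
  · by_cases hs : K.1.inf' K.2 F.idx ≤ s.castSucc
    · have hc : ContinuousAt (fun ρ : Fin (r + 1) → ℝ =>
          ρ (F.idx i) / ρ (K.1.inf' K.2 F.idx)) ρ' :=
        ContinuousAt.div (continuousAt_apply _ _) (continuousAt_apply _ _) (hρ'.1 _ hs).ne'
      exact hc.tendsto.mono_left nhdsWithin_le_nhds
    · -- All vertices of `K` lie in parts after `V_s`, and `i` in a part after `V_{s+1}`.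
      have h1 : s.castSucc < K.1.inf' K.2 F.idx := not_le.1 hs
      have h2 : s.succ < F.idx i := (Fin.castSucc_lt_iff_succ_le.1 h1).trans_lt (hi.lt_of_ne' h)
      refine (tendsto_congr' ?_).2 tendsto_const_nhds
      filter_upwards [self_mem_nhdsWithin] with ρ hρ
      rw [hρ.2.1 _ h2, hρ'.2.1 _ (h1.trans_le hi), zero_div, zero_div]

end Quot

/-! ### The iterated limit of the slices -/

section Limit

theorem continuous_compContinuousLinearMap {k : ℕ} {E₀ E' E : Type*} [NormedAddCommGroup E₀]
    [NormedSpace ℝ E₀] [NormedAddCommGroup E'] [NormedSpace ℝ E'] [NormedAddCommGroup E]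
    [NormedSpace ℝ E] (g : E₀ →L[ℝ] E') :
    Continuous fun p : (E' →L[ℝ] E) × (E [⋀^Fin k]→L[ℝ] ℝ) =>
      p.2.compContinuousLinearMap (p.1.comp g) := by
  have h : Continuous fun p : (E' →L[ℝ] E) × (E [⋀^Fin k]→L[ℝ] ℝ) =>
      (ContinuousAlternatingMap.compContinuousLinearMapCLM (p.1.comp g) :
        (E [⋀^Fin k]→L[ℝ] ℝ) →L[ℝ] (E₀ [⋀^Fin k]→L[ℝ] ℝ)) :=
    ContinuousAlternatingMap.continuous_compContinuousLinearMapCLM.comp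
      (continuous_fst.clm_comp continuous_const)
  exact h.clm_apply continuous_snd

variable {V : Type*} [Fintype V] [DecidableEq V] {r k : ℕ}

/-- The pullback to the angular space of a form on the blow-up along `θ ↦ quot m θ`. -/
def Flag.quotPullback (F : Flag V r) (ψt : FormOn k (blowUp V)) {m : Ambient V} (hm : IsWeight m)
    (hmaps : MapsTo (quot m) F.openAngular (blowUp V)) : FormOn k F.openAngular :=
  FormOn.pullback (quot m) (F.differentiableOn_quot hm) hmaps ψt

theorem Flag.quotPullback_apply (F : Flag V r) (ψt : FormOn k (blowUp V)) {m : Ambient V}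
    (hm : IsWeight m) (hmaps : MapsTo (quot m) F.openAngular (blowUp V)) (θ : F.openAngular)
    (w : Fin k → TangentSpan F.openAngular (θ : V → ℝ)) :
    F.quotPullback ψt hm hmaps θ w = ψt.eval (quot m θ) fun a => quotDeriv m θ (w a) :=
  FormOn.pullback_apply _ _ _
    (hasFDerivAt_quot (hm.weightedSum_ne_zero θ.2.1)).hasFDerivWithinAt _

theorem openSimplex_eq_radialFace_last (r : ℕ) :
    openSimplex (Fin (r + 1)) = radialFace (Fin.last r) := by
  ext ρ
  exact ⟨fun h => ⟨fun j _ => h.1 j, fun j hj => absurd hj (Fin.le_last j).not_gt, h.2⟩,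
    fun h => ⟨fun j => h.1 j (Fin.le_last j), h.2.2⟩⟩

/-- By the chain rule, the slice `ψ_ρ` is the pullback of `ψ̃` along `quot (radialWeight ρ)`. -/
theorem Flag.slice_pushToSimplex (F : Flag V r) (ψt : FormOn k (blowUp V))
    (ρ : openSimplex (Fin (r + 1))) (hm : IsWeight (F.radialWeight ρ))
    (hmaps : MapsTo (quot (F.radialWeight ρ)) F.openAngular (blowUp V)) (θ : F.openAngular) :
    F.slice (pushToSimplex ψt) ρ θ = F.quotPullback ψt hm hmaps θ := by
  ext w
  have h1 : HasFDerivWithinAt (F.quasiCyl ρ) (fderiv ℝ (F.quasiCyl ρ) θ) F.openAngular θ :=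
    (F.quasiCyl_differentiable ρ θ).hasFDerivAt.hasFDerivWithinAt
  have hmem := F.quasiCyl_mapsTo ρ.2 θ.2
  have h2 : HasFDerivWithinAt lift (fderivWithin ℝ lift (openSimplex V) (F.quasiCyl ρ θ))
      (openSimplex V) (F.quasiCyl ρ θ) := (lift_differentiableOn _ hmem).hasFDerivWithinAt
  have h3 : HasFDerivWithinAt (quot (F.radialWeight ρ))
      ((fderivWithin ℝ lift (openSimplex V) (F.quasiCyl ρ θ)).comp (fderiv ℝ (F.quasiCyl ρ) θ))
      F.openAngular θ :=
    (h2.comp (θ : V → ℝ) h1 (F.quasiCyl_mapsTo ρ.2)).congr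
      (fun t _ => F.quot_radialWeight_eq_lift ρ.2 t) (F.quot_radialWeight_eq_lift ρ.2 _)
  rw [Flag.slice, FormOn.pullback_apply _ _ _ h1, pushToSimplex,
    FormOn.eval_pullback _ _ _ hmem h2
      (fun a => hasFDerivWithinAt_mem_tangentSpan h1 (F.quasiCyl_mapsTo ρ.2) (w a).2),
    Flag.quotPullback, FormOn.pullback_apply _ _ _ h3, F.quot_radialWeight_eq_lift ρ.2]
  rfl

open Classical in
/-- The successive limits of the slices at the point `θ`. -/
def Flag.partialLimit (F : Flag V r) (ψt : FormOn k (blowUp V)) (θ : F.openAngular)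
    (s : Fin (r + 1)) (ρ : Fin (r + 1) → ℝ) :
    TangentSpan F.openAngular (θ : V → ℝ) [⋀^Fin k]→L[ℝ] ℝ :=
  if h : ρ ∈ radialFace s then
    F.quotPullback ψt (F.isWeight_radialWeight (radialFace_nonneg h))
      (F.quot_radialWeight_mapsTo h) θ
  else 0

/-- Up to and including the boundary of the radial simplex, a smooth form on the blow-up pulls back
to a form that depends continuously on `ρ`. -/
theorem Flag.tendsto_partialLimit (F : Flag V r) {ψt : FormOn k (blowUp V)}
    (hψt : SmoothForm ψt) (θ : F.openAngular) (s : Fin r) {ρ' : Fin (r + 1) → ℝ}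
    (hρ' : ρ' ∈ radialFace s.castSucc) :
    Tendsto (F.partialLimit ψt θ s.succ) (𝓝[radialFace s.succ] ρ')
      (𝓝 (F.partialLimit ψt θ s.castSucc ρ')) := by
  have hm' := F.isWeight_radialWeight (radialFace_nonneg hρ')
  have hne := hm'.weightedSum_ne_zero θ.2.1
  obtain ⟨U, hU, hxU, η, hη, hev⟩ := hψt.exists_eval_eq (F.quot_radialWeight_mapsTo hρ' θ.2)
  -- Near the limit point, the pullback is given by the ambient form `η`.
  have key : ∀ (t : Fin (r + 1)) (ρ : Fin (r + 1) → ℝ), ρ ∈ radialFace t →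
      quot (F.radialWeight ρ) θ ∈ U → F.partialLimit ψt θ t ρ =
        (η (quot (F.radialWeight ρ) θ)).compContinuousLinearMap
          ((quotDeriv (F.radialWeight ρ) θ).comp
            (TangentSpan F.openAngular (θ : V → ℝ)).subtypeL) := by
    intro t ρ hρ hρU
    rw [Flag.partialLimit, dif_pos hρ]
    ext w
    rw [Flag.quotPullback_apply, hev _ (F.quot_radialWeight_mapsTo hρ θ.2) hρU]
    · rfl
    · exact fun a => hasFDerivWithinAt_mem_tangentSpan (hasFDerivAt_quot
        ((F.isWeight_radialWeight (radialFace_nonneg hρ)).weightedSum_ne_zero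
          θ.2.1)).hasFDerivWithinAt (F.quot_radialWeight_mapsTo hρ) (w a).2
  rw [key _ ρ' hρ' hxU]
  have hp : Tendsto (fun ρ => (F.radialWeight ρ, (θ : V → ℝ))) (𝓝[radialFace s.succ] ρ')
      (𝓝 (F.radialWeight ρ', (θ : V → ℝ))) :=
    (F.tendsto_radialWeight s hρ').prodMk_nhds tendsto_const_nhds
  have hq : Tendsto (fun ρ => quot (F.radialWeight ρ) θ) (𝓝[radialFace s.succ] ρ')
      (𝓝 (quot (F.radialWeight ρ') θ)) :=
    (contDiffAt_quot hne (n := 0)).continuousAt.tendsto.comp hp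
  have hd : Tendsto (fun ρ => quotDeriv (F.radialWeight ρ) θ) (𝓝[radialFace s.succ] ρ')
      (𝓝 (quotDeriv (F.radialWeight ρ') θ)) := (continuousAt_quotDeriv hne).tendsto.comp hp
  have hη' : ContinuousAt η (quot (F.radialWeight ρ') θ) := hη.continuousAt (hU.mem_nhds hxU)
  have hc := (continuous_compContinuousLinearMap (k := k) (E := Ambient V)
    (TangentSpan F.openAngular (θ : V → ℝ)).subtypeL)
  have hlim := (hc.tendsto _).comp (hd.prodMk_nhds (hη'.tendsto.comp hq))
  refine hlim.congr' ?_
  filter_upwards [self_mem_nhdsWithin, hq.eventually (hU.mem_nhds hxU)] with ρ h1 h2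
  exact (key _ ρ h1 h2).symm

theorem single_mem_radialFace_zero (r : ℕ) :
    (Pi.single 0 1 : Fin (r + 1) → ℝ) ∈ radialFace (0 : Fin (r + 1)) := by
  refine ⟨fun j hj => ?_, fun j hj => ?_, by simp⟩
  · rw [Fin.le_zero_iff.1 hj]; simp
  · simp [hj.ne']

theorem Flag.quot_leadWeight_mapsTo_blowUp (F : Flag V r) :
    MapsTo (quot (leadWeight F.idx)) F.openAngular (blowUp V) := by
  rw [← F.radialWeight_eq_leadWeight (single_mem_radialFace_zero r)]
  exact F.quot_radialWeight_mapsTo (single_mem_radialFace_zero r)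

/-- The iterated limit of the slices, as a form on the interior of the angular space. -/
def Flag.limitForm (F : Flag V r) (ψt : FormOn k (blowUp V)) : FormOn k F.openAngular :=
  F.quotPullback ψt (isWeight_leadWeight F.idx) F.quot_leadWeight_mapsTo_blowUp

theorem Flag.hasIteratedLimit_slice (F : Flag V r) {ψt : FormOn k (blowUp V)}
    (hψt : SmoothForm ψt) (θ : F.openAngular) :
    HasIteratedLimit (fun ρ => F.slice (pushToSimplex ψt) ρ θ) (F.limitForm ψt θ) := by
  refine ⟨F.partialLimit ψt θ, fun ρ => ?_, fun s ρ' hρ' => F.tendsto_partialLimit hψt θ s hρ',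
    fun ρ hρ => ?_⟩
  · have hρ : (ρ : Fin (r + 1) → ℝ) ∈ radialFace (Fin.last r) :=
      openSimplex_eq_radialFace_last r ▸ ρ.2
    rw [Flag.partialLimit, dif_pos hρ]
    exact (F.slice_pushToSimplex ψt ρ _ _ θ).symm
  · rw [Flag.partialLimit, dif_pos hρ, Flag.limitForm]
    ext w
    rw [Flag.quotPullback_apply, Flag.quotPullback_apply, F.radialWeight_eq_leadWeight hρ]

end Limit

/-! ### An affine chart of the angular space -/

section Chart

variable {V : Type*} [Fintype V] [DecidableEq V] {r k : ℕ}

/-- The barycentre of the angular space. -/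
def Flag.barycenter (F : Flag V r) : V → ℝ := fun i => ((F.part (F.idx i)).card : ℝ)⁻¹

theorem Flag.barycenter_mem (F : Flag V r) : F.barycenter ∈ F.openAngular := by
  have hcard : ∀ j, 0 < (F.part j).card := fun j => by
    obtain ⟨i, hi⟩ := F.surjective j
    exact Finset.card_pos.2 ⟨i, by simp [Flag.part, hi]⟩
  refine ⟨fun i => inv_pos.2 (by exact_mod_cast hcard _), fun j => ?_⟩
  calc ∑ i ∈ F.part j, F.barycenter i = ∑ i ∈ F.part j, ((F.part j).card : ℝ)⁻¹ :=
        Finset.sum_congr rfl fun i hi => by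
          simp only [Flag.part, Finset.mem_filter] at hi
          simp [Flag.barycenter, hi.2]
    _ = 1 := by
        have : ((F.part j).card : ℝ) ≠ 0 := by exact_mod_cast (hcard j).ne'
        rw [Finset.sum_const, nsmul_eq_mul, mul_inv_cancel₀ this]

/-- The linear map `u ↦ ∑_a u_a b_a`. -/
def Flag.chartLinear (F : Flag V r) (b : Module.Basis (Fin k) ℝ F.angularDir) :
    (Fin k → ℝ) →L[ℝ] V → ℝ :=
  LinearMap.toContinuousLinearMap
    (F.angularDir.subtype ∘ₗ (b.equivFun.symm : (Fin k → ℝ) →ₗ[ℝ] F.angularDir))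

theorem Flag.chartLinear_apply (F : Flag V r) (b : Module.Basis (Fin k) ℝ F.angularDir)
    (u : Fin k → ℝ) : F.chartLinear b u = (b.equivFun.symm u : F.angularDir) := rfl

theorem Flag.chartLinear_single (F : Flag V r) (b : Module.Basis (Fin k) ℝ F.angularDir)
    (a : Fin k) : F.chartLinear b (Pi.single a 1) = (b a : V → ℝ) := by
  simp [Flag.chartLinear_apply]

theorem Flag.chartLinear_injective (F : Flag V r) (b : Module.Basis (Fin k) ℝ F.angularDir) :
    Function.Injective (F.chartLinear b) :=
  Subtype.val_injective.comp b.equivFun.symm.injective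

/-- The affine chart `u ↦ θ` of the affine span of the angular space. -/
def Flag.chart (F : Flag V r) (b : Module.Basis (Fin k) ℝ F.angularDir) (u : Fin k → ℝ) : V → ℝ :=
  F.barycenter + F.chartLinear b u

theorem Flag.hasFDerivAt_chart (F : Flag V r) (b : Module.Basis (Fin k) ℝ F.angularDir)
    (u : Fin k → ℝ) : HasFDerivAt (F.chart b) (F.chartLinear b) u :=
  (F.chartLinear b).hasFDerivAt.const_add F.barycenter

theorem Flag.contDiff_chart (F : Flag V r) (b : Module.Basis (Fin k) ℝ F.angularDir)
    {n : WithTop ℕ∞} : ContDiff ℝ n (F.chart b) :=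
  contDiff_const.add (F.chartLinear b).contDiff

theorem Flag.chart_injective (F : Flag V r) (b : Module.Basis (Fin k) ℝ F.angularDir) :
    Function.Injective (F.chart b) := fun _ _ h => F.chartLinear_injective b (add_left_cancel h)

/-- The domain of the chart of the interior of the angular space. -/
def Flag.chartDom (F : Flag V r) (b : Module.Basis (Fin k) ℝ F.angularDir) : Set (Fin k → ℝ) :=
  {u | ∀ i, 0 < F.chart b u i}

theorem Flag.isOpen_chartDom (F : Flag V r) (b : Module.Basis (Fin k) ℝ F.angularDir) :
    IsOpen (F.chartDom b) := by
  simp only [Flag.chartDom, ofPred_forall]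
  exact isOpen_iInter_of_finite fun i => isOpen_lt continuous_const
    ((continuous_apply i).comp (F.contDiff_chart b (n := 0)).continuous)

theorem Flag.chart_mapsTo (F : Flag V r) (b : Module.Basis (Fin k) ℝ F.angularDir) :
    MapsTo (F.chart b) (F.chartDom b) F.openAngular := by
  refine fun u hu => ⟨hu, fun j => ?_⟩
  simp only [Flag.chart, Pi.add_apply, Finset.sum_add_distrib, F.barycenter_mem.2 j]
  rw [show ∑ i ∈ F.part j, F.chartLinear b u i = 0 from (b.equivFun.symm u).2 j, add_zero]

theorem Flag.openAngular_subset_image_chart (F : Flag V r)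
    (b : Module.Basis (Fin k) ℝ F.angularDir) :
    F.openAngular ⊆ F.chart b '' F.chartDom b := by
  intro θ hθ
  have hmem : θ - F.barycenter ∈ F.angularDir := fun j => by
    simp only [Pi.sub_apply, Finset.sum_sub_distrib, hθ.2 j, F.barycenter_mem.2 j, sub_self]
  have h : F.chart b (b.equivFun ⟨_, hmem⟩) = θ := by
    simp [Flag.chart, Flag.chartLinear_apply]
  exact ⟨_, fun i => (hθ.1 i).trans_eq (congrFun h i).symm, h⟩

theorem Flag.angularPos_basis (F : Flag V r) (b : Module.Basis (Fin k) ℝ F.angularDir) :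
    F.AngularPos b fun a => (b a : V → ℝ) :=
  ⟨fun a => (b a).2, by
    change 0 < b.det b
    rw [b.det_self]
    exact one_pos⟩

/-- The affine parametrization of the interior of the angular space. -/
def Flag.angularParam (F : Flag V r) (b : Module.Basis (Fin k) ℝ F.angularDir) :
    OrientedParam k F.openAngular (F.AngularPos b) where
  dom := F.chartDom b
  isOpen := F.isOpen_chartDom b
  toFun := F.chart b
  smooth := (F.contDiff_chart b).contDiffOn
  mapsTo := F.chart_mapsTo b
  injOn := (F.chart_injective b).injOn
  immersion u _ := by
    rw [(F.hasFDerivAt_chart b u).fderiv]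
    exact F.chartLinear_injective b
  positive u _ := by
    simp only [(F.hasFDerivAt_chart b u).fderiv, F.chartLinear_single b]
    exact F.angularPos_basis b
  conull := by
    rw [sdiff_eq_empty.2 (F.openAngular_subset_image_chart b), measure_empty]

end Chart

/-! ### Integrability of the minors -/

section Jacobian

variable {V : Type*} [Fintype V] [DecidableEq V] {r k : ℕ}

/-- The map `Fin k → ℝ` to itself that consists of `k` coordinates of `quot m` in the chart. -/
def Flag.coordMap (F : Flag V r) (b : Module.Basis (Fin k) ℝ F.angularDir) (m : Ambient V)
    (α : Fin k → Σ K : Face V, K.1) (u : Fin k → ℝ) : Fin k → ℝ :=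
  fun c => quot m (F.chart b u) (α c).1 (α c).2

/-- The derivative of `coordMap`. -/
def Flag.coordDeriv (F : Flag V r) (b : Module.Basis (Fin k) ℝ F.angularDir) (m : Ambient V)
    (α : Fin k → Σ K : Face V, K.1) (u : Fin k → ℝ) : (Fin k → ℝ) →L[ℝ] Fin k → ℝ :=
  ContinuousLinearMap.pi fun c => (ContinuousLinearMap.proj (α c).2).comp
    ((ContinuousLinearMap.proj (α c).1).comp
      ((quotDeriv m (F.chart b u)).comp (F.chartLinear b)))

variable (F : Flag V r) (b : Module.Basis (Fin k) ℝ F.angularDir) {m : Ambient V}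
  (α : Fin k → Σ K : Face V, K.1)

theorem Flag.hasFDerivAt_quot_chart (hm : IsWeight m) {u : Fin k → ℝ} (hu : u ∈ F.chartDom b) :
    HasFDerivAt (fun u => quot m (F.chart b u))
      ((quotDeriv m (F.chart b u)).comp (F.chartLinear b)) u :=
  (hasFDerivAt_quot (hm.weightedSum_ne_zero hu)).comp u (F.hasFDerivAt_chart b u)

theorem Flag.hasFDerivAt_coordMap (hm : IsWeight m) {u : Fin k → ℝ} (hu : u ∈ F.chartDom b) :
    HasFDerivAt (F.coordMap b m α) (F.coordDeriv b m α u) u :=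
  hasFDerivAt_pi.2 fun c => hasFDerivAt_pi'.1
    (hasFDerivAt_pi'.1 (F.hasFDerivAt_quot_chart b hm hu) (α c).1) (α c).2

theorem Flag.continuousOn_quotDeriv_chart (hm : IsWeight m) :
    ContinuousOn (fun u => quotDeriv m (F.chart b u)) (F.chartDom b) := fun u hu =>
  ((continuousAt_quotDeriv (hm.weightedSum_ne_zero hu)).comp (x := u)
    (f := fun u => (m, F.chart b u)) (continuousAt_const.prodMk
      (F.contDiff_chart b (n := 0)).continuous.continuousAt)).continuousWithinAt

theorem Flag.det_coordDeriv (u : Fin k → ℝ) :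
    (F.coordDeriv b m α u).det = (Matrix.of fun a c =>
      quotDeriv m (F.chart b u) (b a) (α c).1 (α c).2).det := by
  rw [ContinuousLinearMap.det, ← LinearMap.det_toMatrix', ← Matrix.det_transpose]
  congr 1
  ext a c
  simp [LinearMap.toMatrix'_apply, Flag.coordDeriv, ← F.chartLinear_single b]

theorem Flag.continuousOn_det_coordDeriv (hm : IsWeight m) :
    ContinuousOn (fun u => (F.coordDeriv b m α u).det) (F.chartDom b) := by
  simp only [Flag.det_coordDeriv]
  refine fun u hu => ContinuousAt.continuousWithinAt ?_
  have h : ContinuousAt (fun u => quotDeriv m (F.chart b u)) u :=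
    (F.continuousOn_quotDeriv_chart b hm).continuousAt ((F.isOpen_chartDom b).mem_nhds hu)
  have h1 : ContinuousAt (fun u => (Matrix.of fun a c =>
      quotDeriv m (F.chart b u) (b a) (α c).1 (α c).2 : Matrix (Fin k) (Fin k) ℝ)) u := by
    refine continuousAt_pi.2 fun a => continuousAt_pi.2 fun c => ?_
    exact continuousAt_pi.1 (continuousAt_pi.1 (h.clm_apply continuousAt_const) (α c).1) (α c).2
  exact (continuous_id.matrix_det.continuousAt).comp h1

/-- The fibres of `coordMap` are given by linear equations, so that the derivative annihilates the
difference of any two points of a fibre. -/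
theorem Flag.injOn_coordMap (hm : IsWeight m) :
    InjOn (F.coordMap b m α) {u ∈ F.chartDom b | (F.coordDeriv b m α u).det ≠ 0} := by
  rintro u ⟨hu, hdet⟩ u' ⟨hu', -⟩ h
  have hz : F.coordDeriv b m α u (u' - u) = 0 := by
    funext c
    have h1 := hm.weightedSum_ne_zero hu (α c).1
    have h2 := hm.weightedSum_ne_zero hu' (α c).1
    have h3 := quotDeriv_mul_weightedSum (hm.weightedSum_ne_zero hu)
      (F.chartLinear b (u' - u)) (α c).1 (α c).2
    have h4 : F.chartLinear b (u' - u) = F.chart b u' - F.chart b u := by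
      simp [Flag.chart]
    have h5 : weightedSum m (F.chartLinear b (u' - u)) (α c).1
        = weightedSum m (F.chart b u') (α c).1 - weightedSum m (F.chart b u) (α c).1 := by
      simp only [h4, weightedSum, Pi.sub_apply, mul_sub, Finset.sum_sub_distrib]
    have e1 : quot m (F.chart b u) (α c).1 (α c).2 * weightedSum m (F.chart b u) (α c).1
        = m (α c).1 (α c).2 * F.chart b u (α c).2 := div_mul_cancel₀ _ h1
    have e2 : quot m (F.chart b u) (α c).1 (α c).2 * weightedSum m (F.chart b u') (α c).1
        = m (α c).1 (α c).2 * F.chart b u' (α c).2 := by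
      rw [show quot m (F.chart b u) (α c).1 (α c).2 = quot m (F.chart b u') (α c).1 (α c).2 from
        congrFun h c]
      exact div_mul_cancel₀ _ h2
    have h6 : F.chartLinear b (u' - u) (α c).2
        = F.chart b u' (α c).2 - F.chart b u (α c).2 := congrFun h4 _
    rw [h5, h6] at h3
    have h7 : quotDeriv m (F.chart b u) (F.chartLinear b (u' - u)) (α c).1 (α c).2
        * weightedSum m (F.chart b u) (α c).1 = 0 := by linear_combination h3 + e1 - e2
    exact (mul_eq_zero.1 h7).resolve_right h1
  have hinj : Function.Injective (F.coordDeriv b m α u) :=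
    ((F.coordDeriv b m α u).toContinuousLinearEquivOfDetNeZero hdet).injective
  exact (sub_eq_zero.1 (hinj (hz.trans (map_zero _).symm))).symm

/-- The minors of the derivative of `quot m` in the chart are integrable: where a minor does not
vanish, it is the Jacobian of an injective map into the unit cube. -/
theorem Flag.integrableOn_det_coordDeriv (hm : IsWeight m) :
    IntegrableOn (fun u => (F.coordDeriv b m α u).det) (F.chartDom b) := by
  have hmeas := (F.isOpen_chartDom b).measurableSet
  have hcont := F.continuousOn_det_coordDeriv b α hm
  refine ⟨hcont.aestronglyMeasurable hmeas, ?_⟩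
  set A := {u ∈ F.chartDom b | (F.coordDeriv b m α u).det ≠ 0} with hA
  have hAo : IsOpen A := hcont.isOpen_inter_preimage (F.isOpen_chartDom b) isOpen_ne
  have h1 := lintegral_abs_det_fderiv_eq_addHaar_image volume hAo.measurableSet
    (fun u hu => (F.hasFDerivAt_coordMap b α hm hu.1).hasFDerivWithinAt)
    (F.injOn_coordMap b α hm)
  have h2 : F.coordMap b m α '' A ⊆ Icc 0 1 := by
    rintro _ ⟨u, hu, rfl⟩
    refine ⟨fun c => hm.quot_nonneg hu.1 _ _, fun c => ?_⟩
    rw [Pi.one_apply, ← hm.sum_quot hu.1 (α c).1]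
    exact Finset.single_le_sum (fun i _ => hm.quot_nonneg hu.1 _ i) (Finset.mem_univ (α c).2)
  have h3 : ∫⁻ u in F.chartDom b, ‖(F.coordDeriv b m α u).det‖ₑ
      = ∫⁻ u in A, ENNReal.ofReal |(F.coordDeriv b m α u).det| := by
    simp only [Real.enorm_eq_ofReal_abs]
    rw [← lintegral_indicator hmeas, ← lintegral_indicator hAo.measurableSet]
    refine lintegral_congr fun u => ?_
    by_cases hu : u ∈ A
    · rw [indicator_of_mem hu, indicator_of_mem hu.1]
    · rw [indicator_of_notMem hu, indicator_apply_eq_zero]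
      intro hu'
      have : (F.coordDeriv b m α u).det = 0 := by
        by_contra h
        exact hu ⟨hu', h⟩
      simp [this]
  rw [hasFiniteIntegral_iff_enorm, h3, h1]
  exact (measure_mono h2).trans_lt isCompact_Icc.measure_lt_top

end Jacobian

/-! ### Strata of the blow-up -/

section Strata

variable {V : Type*} [Fintype V] [DecidableEq V] {r k : ℕ}

/-- The coordinate `λ_i^K`, extended by `0` to arbitrary `K` and `i`. -/
def coord (x : Ambient V) (K : Finset V) (i : V) : ℝ :=
  if h : i ∈ K then x ⟨K, i, h⟩ ⟨i, h⟩ else 0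

theorem coord_of_mem (x : Ambient V) {K : Face V} (i : K.1) : coord x K.1 i = x K i :=
  dif_pos i.2

theorem coord_nonneg {x : Ambient V} (hx : x ∈ blowUp V) (K : Finset V) (i : V) :
    0 ≤ coord x K i := by
  unfold coord
  split_ifs
  · exact hx.1 _ _
  · exact le_rfl

theorem sum_coord {x : Ambient V} (hx : x ∈ blowUp V) {K : Finset V} (hK : K.Nonempty) :
    ∑ i ∈ K, coord x K i = 1 := by
  rw [← hx.2.1 ⟨K, hK⟩, ← Finset.sum_coe_sort K]
  exact Finset.sum_congr rfl fun i _ => coord_of_mem x (K := ⟨K, hK⟩) i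

theorem coord_eq_sum_mul {x : Ambient V} (hx : x ∈ blowUp V) {K H : Finset V} (h : K ⊆ H) {i : V}
    (hi : i ∈ K) : coord x H i = (∑ i' ∈ K, coord x H i') * coord x K i := by
  have hK : K.Nonempty := ⟨i, hi⟩
  have h1 := hx.2.2 ⟨K, hK⟩ ⟨H, hK.mono h⟩ h ⟨i, hi⟩
  rw [← coord_of_mem x (K := ⟨K, hK⟩) ⟨i, hi⟩,
    ← coord_of_mem x (K := ⟨H, hK.mono h⟩) ⟨i, h hi⟩] at h1
  rw [← Finset.sum_coe_sort K]
  refine h1.trans ?_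
  congr 1
  exact Finset.sum_congr rfl fun i' _ =>
    (coord_of_mem x (K := ⟨H, hK.mono h⟩) ⟨i', h i'.2⟩).symm

/-- At the point `x` of the blow-up, `λ_{i'}` is infinitely small compared with `λ_i`. -/
def Dominates (x : Ambient V) (i i' : V) : Prop := coord x {i, i'} i' = 0

theorem Dominates.coord_eq_zero {x : Ambient V} (hx : x ∈ blowUp V) {i i' : V}
    (h : Dominates x i i') {K : Finset V} (hi : i ∈ K) (hi' : i' ∈ K) : coord x K i' = 0 := by
  have hs : {i, i'} ⊆ K := by simp [Finset.insert_subset_iff, hi, hi']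
  rw [coord_eq_sum_mul hx hs (by simp), show coord x {i, i'} i' = 0 from h, mul_zero]

theorem coord_eq_zero_of_not_dominates {x : Ambient V} (hx : x ∈ blowUp V) {i i' : V}
    (h : ¬ Dominates x i i') {K : Finset V} (hi : i ∈ K) (hi' : i' ∈ K)
    (h0 : coord x K i' = 0) : coord x K i = 0 := by
  have hs : {i, i'} ⊆ K := by simp [Finset.insert_subset_iff, hi, hi']
  rw [coord_eq_sum_mul hx hs (by simp)] at h0
  exact (Finset.sum_eq_zero_iff_of_nonneg fun j _ => coord_nonneg hx K j).1
    ((mul_eq_zero.1 h0).resolve_right h) i (by simp)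

theorem Dominates.asymm {x : Ambient V} (hx : x ∈ blowUp V) {i i' : V}
    (h : Dominates x i i') : ¬ Dominates x i' i := by
  intro h'
  have h1 := sum_coord hx (K := {i, i'}) (by simp)
  rw [Finset.sum_eq_zero fun j hj => ?_] at h1
  · exact zero_ne_one h1
  · rcases Finset.mem_insert.1 hj with rfl | hj
    · exact h'.coord_eq_zero hx (by simp) (by simp)
    · rw [Finset.mem_singleton.1 hj]
      exact h

theorem Dominates.or_dominates {x : Ambient V} (hx : x ∈ blowUp V) {i i'' : V}
    (h : Dominates x i i'') (i' : V) : Dominates x i i' ∨ Dominates x i' i'' := by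
  by_contra! hcon
  have h2 : coord x {i, i', i''} i'' = 0 := h.coord_eq_zero hx (by simp) (by simp)
  have h1 : coord x {i, i', i''} i' = 0 :=
    coord_eq_zero_of_not_dominates hx hcon.2 (by simp) (by simp) h2
  have h0 : coord x {i, i', i''} i = 0 :=
    coord_eq_zero_of_not_dominates hx hcon.1 (by simp) (by simp) h1
  have hs := sum_coord hx (K := {i, i', i''}) (by simp)
  rw [Finset.sum_eq_zero fun j hj => ?_] at hs
  · exact zero_ne_one hs
  · simp only [Finset.mem_insert, Finset.mem_singleton] at hj
    rcases hj with rfl | rfl | rfl <;> assumption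

/-- Comparison of magnitudes at a point of the blow-up is a strict weak order, hence is given by a
rank function: the number of vertices that dominate a given one. -/
theorem exists_rank {x : Ambient V} (hx : x ∈ blowUp V) :
    ∃ c : V → ℕ, ∀ i i', c i < c i' ↔ Dominates x i i' := by
  classical
  refine ⟨fun i => (Finset.univ.filter fun j => Dominates x j i).card, fun i i' =>
    ⟨fun h => ?_, fun h => Finset.card_lt_card ?_⟩⟩
  · by_contra hcon
    refine h.not_ge (Finset.card_le_card fun j hj => ?_)
    simp only [Finset.mem_filter, Finset.mem_univ, true_and] at hj ⊢
    exact (hj.or_dominates hx i).resolve_right hcon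
  · refine (Finset.ssubset_iff_of_subset fun j hj => ?_).2 ⟨i, by simpa using h, ?_⟩
    · simp only [Finset.mem_filter, Finset.mem_univ, true_and] at hj ⊢
      exact (hj.or_dominates hx i').resolve_right (h.asymm hx)
    · simp only [Finset.mem_filter, Finset.mem_univ, true_and]
      exact fun h' => h'.asymm hx h'

/-- The parameter space of the stratum of the blow-up that belongs to the ordered partition of `V`
into the fibres of `c`. -/
def stratumDom {ι : Type*} [DecidableEq ι] (c : V → ι) : Set (V → ℝ) :=
  {θ | (∀ i, 0 < θ i) ∧ ∀ i, ∑ i' ∈ Finset.univ.filter (fun i' => c i' = c i), θ i' = 1}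

/-- Every point of the blow-up lies in the stratum of its order of magnitudes. -/
theorem exists_quot_leadWeight_eq {ι : Type*} [LinearOrder ι] {x : Ambient V} (hx : x ∈ blowUp V)
    {c : V → ι} (hc : ∀ i i', c i < c i' ↔ Dominates x i i') :
    ∃ θ ∈ stratumDom c, quot (leadWeight c) θ = x := by
  set θ : V → ℝ := fun i => coord x (Finset.univ.filter fun i' => c i' = c i) i with hθ
  have hpos : ∀ i, 0 < θ i := fun i => by
    refine (coord_nonneg hx _ i).lt_of_ne' fun h0 => ?_
    have hs := sum_coord hx (K := Finset.univ.filter fun i' => c i' = c i) ⟨i, by simp⟩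
    rw [Finset.sum_eq_zero fun j hj => ?_] at hs
    · exact zero_ne_one hs
    · refine coord_eq_zero_of_not_dominates hx (i := j) (i' := i) ?_ hj (by simp) h0
      rw [← hc, (Finset.mem_filter.1 hj).2]
      exact lt_irrefl _
  refine ⟨θ, ⟨hpos, fun i => ?_⟩, ?_⟩
  · rw [← sum_coord hx (K := Finset.univ.filter fun i' => c i' = c i) ⟨i, by simp⟩]
    refine Finset.sum_congr rfl fun j hj => ?_
    simp only [hθ, (Finset.mem_filter.1 hj).2]
  funext K i
  obtain ⟨i₀, hi₀, hmin⟩ := K.1.exists_mem_eq_inf' K.2 c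
  -- The vertices of `K` of the largest magnitude.
  set K' := K.1.filter fun i => c i = K.1.inf' K.2 c with hK'
  have hsub : K' ⊆ K.1 := Finset.filter_subset _ _
  have hi₀' : i₀ ∈ K' := Finset.mem_filter.2 ⟨hi₀, hmin.symm⟩
  have hzero : ∀ j ∈ K.1, j ∉ K' → coord x K.1 j = 0 := fun j hj hj' => by
    have h1 : c j ≠ K.1.inf' K.2 c := fun h => hj' (Finset.mem_filter.2 ⟨hj, h⟩)
    have h2 : c i₀ < c j := hmin ▸ (Finset.inf'_le c hj).lt_of_ne' h1
    exact ((hc _ _).1 h2).coord_eq_zero hx hi₀ hj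
  have hsum : weightedSum (leadWeight c) θ K = ∑ j ∈ K', θ j := by
    rw [hK', Finset.sum_filter, ← Finset.sum_coe_sort K.1]
    exact Finset.sum_congr rfl fun j _ => by simp [leadWeight]
  simp only [quot]
  rw [hsum, ← coord_of_mem x i]
  by_cases hi : (i : V) ∈ K'
  · have hci : c i = K.1.inf' K.2 c := (Finset.mem_filter.1 hi).2
    have hH : K' ⊆ Finset.univ.filter fun i' => c i' = c i := fun j hj => by
      simp [(Finset.mem_filter.1 hj).2, hci]
    have h1 : θ i = (∑ j ∈ K', θ j) * coord x K' i := by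
      simp only [hθ]
      rw [coord_eq_sum_mul hx hH hi]
      congr 1
      refine Finset.sum_congr rfl fun j hj => ?_
      rw [(Finset.mem_filter.1 hj).2, hci]
    have h2 : coord x K.1 i = coord x K' i := by
      rw [coord_eq_sum_mul hx hsub hi, Finset.sum_subset hsub hzero, sum_coord hx K.2, one_mul]
    have h3 : ∑ j ∈ K', θ j ≠ 0 := (Finset.sum_pos (fun j _ => hpos j) ⟨i₀, hi₀'⟩).ne'
    rw [h2, leadWeight, if_pos hci, one_mul, h1, mul_div_cancel_left₀ _ h3]
  · rw [hzero _ i.2 hi, leadWeight, if_neg fun h => hi (Finset.mem_filter.2 ⟨i.2, h⟩), zero_mul,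
      zero_div]

/-- The directions of `stratumDom c`. -/
def stratumDir {ι : Type*} [DecidableEq ι] (c : V → ι) : Submodule ℝ (V → ℝ) where
  carrier := {w | ∀ i, ∑ i' ∈ Finset.univ.filter (fun i' => c i' = c i), w i' = 0}
  add_mem' := fun hv hw i => by
    simp only [Pi.add_apply, Finset.sum_add_distrib, hv i, hw i, add_zero]
  zero_mem' := fun i => by simp
  smul_mem' := fun a w hw i => by
    simp only [Pi.smul_apply, smul_eq_mul, ← Finset.mul_sum, hw i, mul_zero]

theorem dimH_image_stratumDom_le {ι : Type*} [LinearOrder ι] (c : V → ι) :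
    dimH (quot (leadWeight c) '' stratumDom c) ≤ Module.finrank ℝ (stratumDir c) := by
  have hconv : Convex ℝ {θ : V → ℝ | ∀ i, 0 < θ i} := by
    simp only [ofPred_forall]
    exact convex_iInter fun i => convex_halfSpace_gt (LinearMap.proj i).isLinear 0
  have hsmooth : ContDiffOn ℝ 1 (quot (leadWeight c)) {θ : V → ℝ | ∀ i, 0 < θ i} := fun θ hθ =>
    ((contDiffAt_quot ((isWeight_leadWeight c).weightedSum_ne_zero hθ)).comp θ
      (contDiffAt_const.prodMk contDiffAt_id)).contDiffWithinAt
  refine (hsmooth.dimH_image_le hconv fun θ hθ => hθ.1).trans ?_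
  rcases (stratumDom c).eq_empty_or_nonempty with h | ⟨θ₀, hθ₀⟩
  · simp [h]
  · have hsub : stratumDom c ⊆ range fun w : stratumDir c => θ₀ + (w : V → ℝ) := fun θ hθ =>
      ⟨⟨θ - θ₀, fun i => by
        simp only [Pi.sub_apply, Finset.sum_sub_distrib, hθ.2 i, hθ₀.2 i, sub_self]⟩, by simp⟩
    exact (dimH_mono hsub).trans
      (contDiff_const.add (stratumDir c).subtypeL.contDiff).dimH_range_le

/-- A proper refinement of a flag has fewer angular directions. -/
theorem Flag.stratumDir_lt_angularDir {ι : Type*} [LinearOrder ι] (F : Flag V r) {c : V → ι}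
    (hc : ∀ i i', F.idx i < F.idx i' → c i < c i') {i₁ i₂ : V} (h : F.idx i₁ = F.idx i₂)
    (hne : c i₁ ≠ c i₂) : stratumDir c < F.angularDir := by
  refine lt_of_le_of_ne (fun w hw j => ?_) fun heq => ?_
  · rw [← Finset.sum_fiberwise_of_maps_to (g := c) (t := (F.part j).image c)
      fun i hi => Finset.mem_image_of_mem c hi]
    refine Finset.sum_eq_zero fun n hn => ?_
    obtain ⟨i, hi, rfl⟩ := Finset.mem_image.1 hn
    rw [← hw i]
    refine Finset.sum_congr (Finset.ext fun i' => ?_) fun _ _ => rfl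
    simp only [Flag.part, Finset.mem_filter, Finset.mem_univ, true_and] at hi ⊢
    refine and_iff_right_of_imp fun h' => ?_
    rcases lt_trichotomy (F.idx i') j with hlt | heq | hlt
    · exact absurd h' (hc _ _ (hi ▸ hlt)).ne
    · exact heq
    · exact absurd h' (hc _ _ (hi ▸ hlt)).ne'
  · have hmem : (Pi.single i₁ 1 - Pi.single i₂ 1 : V → ℝ) ∈ F.angularDir := fun j => by
      simp [Finset.sum_sub_distrib, Finset.sum_pi_single', Flag.part, h]
    rw [← heq] at hmem
    have := hmem i₁
    simp [Finset.sum_sub_distrib, Finset.sum_pi_single', hne.symm] at this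

end Strata

/-! ### Parametrization of a face of the blow-up -/

section FaceParam

variable {V : Type*} [Fintype V] [DecidableEq V] {r k : ℕ}

theorem Flag.quot_leadWeight_mapsTo_blowUpFace (F : Flag V r) :
    MapsTo (quot (leadWeight F.idx)) F.openAngular F.blowUpFace := by
  refine fun θ hθ => ⟨F.quot_leadWeight_mapsTo_blowUp hθ, fun i i' h => ?_⟩
  have h1 : (edge i i').1.inf' (edge i i').2 F.idx ≤ F.idx i := Finset.inf'_le _ (by simp [edge])
  simp [quot, leadWeight, (h1.trans_lt h).ne']

theorem Flag.toAngular_quot (F : Flag V r) {θ : V → ℝ} (hθ : θ ∈ F.openAngular) :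
    F.toAngular (quot (leadWeight F.idx) θ) = θ := by
  funext i
  have h1 : ∀ j ∈ F.part (F.idx i),
      F.idx j = (F.part (F.idx i)).inf' ⟨i, by simp [Flag.part]⟩ F.idx := fun j hj => by
    refine le_antisymm (Finset.le_inf' _ _ fun j' hj' => ?_) (Finset.inf'_le _ hj)
    rw [(Finset.mem_filter.1 hj).2, (Finset.mem_filter.1 hj').2]
  have h2 : ∀ j : F.part (F.idx i), leadWeight F.idx ⟨F.part (F.idx i), i, by simp [Flag.part]⟩ j
      = 1 := fun j => if_pos (h1 j j.2)
  simp only [Flag.toAngular, quot, weightedSum, h2, one_mul]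
  rw [Finset.sum_coe_sort (F.part (F.idx i)) θ, hθ.2, div_one]

/-- The projection to the angular space, as a continuous linear map. -/
def Flag.toAngularL (F : Flag V r) : Ambient V →L[ℝ] V → ℝ :=
  LinearMap.toContinuousLinearMap
    { toFun := F.toAngular, map_add' := fun _ _ => rfl, map_smul' := fun _ _ => rfl }

variable (F : Flag V r) (b : Module.Basis (Fin k) ℝ F.angularDir)

theorem Flag.hasFDerivAt_faceChart {u : Fin k → ℝ} (hu : u ∈ F.chartDom b) :
    HasFDerivAt (fun u => quot (leadWeight F.idx) (F.chart b u))
      ((quotDeriv (leadWeight F.idx) (F.chart b u)).comp (F.chartLinear b)) u :=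
  F.hasFDerivAt_quot_chart b (isWeight_leadWeight _) hu

theorem Flag.toAngular_quotDeriv {u : Fin k → ℝ} (hu : u ∈ F.chartDom b) (v : Fin k → ℝ) :
    F.toAngular (quotDeriv (leadWeight F.idx) (F.chart b u) (F.chartLinear b v))
      = F.chartLinear b v := by
  have h1 := F.toAngularL.hasFDerivAt.comp u (F.hasFDerivAt_faceChart b hu)
  have h2 : F.chart b =ᶠ[𝓝 u]
      (F.toAngularL ∘ fun u => quot (leadWeight F.idx) (F.chart b u)) := by
    filter_upwards [(F.isOpen_chartDom b).mem_nhds hu] with u' hu'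
    exact (F.toAngular_quot (F.chart_mapsTo b hu')).symm
  exact DFunLike.congr_fun ((h1.congr_of_eventuallyEq h2).unique (F.hasFDerivAt_chart b u)) v

/-- What the chart misses of a face of the blow-up is contained in the strata of
the proper refinements of the flag, which have smaller dimension. -/
theorem Flag.hausdorffMeasure_diff_faceChart :
    μH[(k : ℝ)] (F.blowUpFace \
      (fun u => quot (leadWeight F.idx) (F.chart b u)) '' F.chartDom b) = 0 := by
  have hcover : F.blowUpFace \ (fun u => quot (leadWeight F.idx) (F.chart b u)) '' F.chartDom b
      ⊆ ⋃ c ∈ {c : V → ℕ | stratumDir c < F.angularDir},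
        quot (leadWeight c) '' stratumDom c := by
    rintro x ⟨⟨hx, hxF⟩, hx'⟩
    have hdom : ∀ i i', F.idx i < F.idx i' → Dominates x i i' := fun i i' h =>
      (coord_of_mem x (K := edge i i') ⟨i', by simp [edge]⟩).trans (hxF i i' h)
    obtain ⟨c, hc⟩ := exists_rank hx
    have hnot : ∃ i i', Dominates x i i' ∧ ¬ F.idx i < F.idx i' := by
      by_contra! hcon
      obtain ⟨θ, hθ, rfl⟩ := exists_quot_leadWeight_eq hx
        fun i i' => ⟨hdom i i', hcon i i'⟩
      have hθ' : θ ∈ F.openAngular := ⟨hθ.1, fun j => by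
        obtain ⟨i, rfl⟩ := F.surjective j
        exact hθ.2 i⟩
      obtain ⟨u, hu, rfl⟩ := F.openAngular_subset_image_chart b hθ'
      exact hx' ⟨u, hu, rfl⟩
    obtain ⟨i, i', hi, hi'⟩ := hnot
    have heq : F.idx i = F.idx i' :=
      ((not_lt.1 hi').eq_of_not_lt fun h => hi.asymm hx (hdom _ _ h)).symm
    obtain ⟨θ, hθ, rfl⟩ := exists_quot_leadWeight_eq hx hc
    exact mem_biUnion (F.stratumDir_lt_angularDir
      (fun j j' h => (hc j j').2 (hdom j j' h)) heq ((hc i i').2 hi).ne) ⟨θ, hθ, rfl⟩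
  refine measure_mono_null hcover ((measure_biUnion_null_iff (to_countable _)).2 fun c hc => ?_)
  have hdim := Submodule.finrank_lt_finrank_of_lt (show stratumDir c < F.angularDir from hc)
  rw [Module.finrank_eq_card_basis b, Fintype.card_fin] at hdim
  have h1 : dimH (quot (leadWeight c) '' stratumDom c) < ((k : NNReal) : ENNReal) :=
    (dimH_image_stratumDom_le c).trans_lt (by simpa using hdim)
  simpa using hausdorffMeasure_of_dimH_lt h1

/-- The parametrization of the interior of a face of the blow-up by the angular space. -/
def Flag.faceParam : OrientedParam k F.blowUpFace (F.FacePos b) where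
  dom := F.chartDom b
  isOpen := F.isOpen_chartDom b
  toFun u := quot (leadWeight F.idx) (F.chart b u)
  smooth u hu :=
    ((contDiffAt_quot ((isWeight_leadWeight _).weightedSum_ne_zero hu)).comp u
      (contDiffAt_const.prodMk (F.contDiff_chart b).contDiffAt)).contDiffWithinAt
  mapsTo u hu := F.quot_leadWeight_mapsTo_blowUpFace (F.chart_mapsTo b hu)
  injOn u hu u' hu' h := F.chart_injective b <| by
    rw [← F.toAngular_quot (F.chart_mapsTo b hu), ← F.toAngular_quot (F.chart_mapsTo b hu')]
    exact congrArg F.toAngular h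
  immersion u hu v v' h := F.chartLinear_injective b <| by
    rw [(F.hasFDerivAt_faceChart b hu).fderiv] at h
    rw [← F.toAngular_quotDeriv b hu v, ← F.toAngular_quotDeriv b hu v']
    exact congrArg F.toAngular h
  positive u hu := by
    simp only [(F.hasFDerivAt_faceChart b hu).fderiv, Flag.FacePos,
      ContinuousLinearMap.comp_apply, F.toAngular_quotDeriv b hu]
    simp only [F.chartLinear_single b]
    exact F.angularPos_basis b
  conull := F.hausdorffMeasure_diff_faceChart b

end FaceParam

/-! ### The integrand -/

section Coefficient

variable {V : Type*} [Fintype V] [DecidableEq V] {r k : ℕ}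
  (F : Flag V r) (b : Module.Basis (Fin k) ℝ F.angularDir) (ψt : FormOn k (blowUp V))

/-- The common coefficient of `ψ̃` on the face of the blow-up and of the limit form on the angular
space, in the chart. -/
def Flag.faceCoeff (u : Fin k → ℝ) : ℝ :=
  ψt.eval (quot (leadWeight F.idx) (F.chart b u))
    fun a => quotDeriv (leadWeight F.idx) (F.chart b u) (b a)

theorem Flag.faceParam_coeff {u : Fin k → ℝ} (hu : u ∈ F.chartDom b) :
    (F.faceParam b).coeff (ψt.restrict F.blowUpFace_subset) u = F.faceCoeff b ψt u := by
  have h := F.hasFDerivAt_faceChart b hu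
  rw [OrientedParam.coeff_eq (F.faceParam b) _ hu h,
    FormOn.eval_restrict _ _ ((F.faceParam b).mapsTo hu) fun a =>
      OrientedParam.derivative_mem_tangentSpan (F.faceParam b) hu h _]
  simp only [ContinuousLinearMap.comp_apply, F.chartLinear_single b]
  rfl

theorem Flag.angularParam_coeff {u : Fin k → ℝ} (hu : u ∈ F.chartDom b) :
    (F.angularParam b).coeff (F.limitForm ψt) u = F.faceCoeff b ψt u := by
  have h := F.hasFDerivAt_chart b u
  have hmem := F.chart_mapsTo b hu
  rw [OrientedParam.coeff_eq (F.angularParam b) _ hu h, Flag.limitForm, Flag.quotPullback]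
  refine (FormOn.eval_pullback _ _ _ hmem (hasFDerivAt_quot
    ((isWeight_leadWeight _).weightedSum_ne_zero hu)).hasFDerivWithinAt fun a =>
      OrientedParam.derivative_mem_tangentSpan (F.angularParam b) hu h _).trans ?_
  simp only [F.chartLinear_single b]
  rfl

theorem Flag.quotDeriv_mem_tangentSpan {u : Fin k → ℝ} (hu : u ∈ F.chartDom b) (a : Fin k) :
    quotDeriv (leadWeight F.idx) (F.chart b u) (b a) ∈
      TangentSpan (blowUp V) (quot (leadWeight F.idx) (F.chart b u)) := by
  have h := hasFDerivWithinAt_mem_tangentSpan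
    (F.hasFDerivAt_faceChart b hu).hasFDerivWithinAt
    (fun u hu => F.quot_leadWeight_mapsTo_blowUp (F.chart_mapsTo b hu))
    (mem_tangentSpan_of_isOpen (F.isOpen_chartDom b) hu (Pi.single a 1))
  rwa [ContinuousLinearMap.comp_apply, F.chartLinear_single b] at h

theorem Flag.continuousOn_faceCoeff {ψt : FormOn k (blowUp V)} (hψt : SmoothForm ψt) :
    ContinuousOn (F.faceCoeff b ψt) (F.chartDom b) := by
  refine fun u hu => ContinuousAt.continuousWithinAt ?_
  have hm := isWeight_leadWeight F.idx
  obtain ⟨U, hU, hxU, η, hη, hev⟩ :=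
    hψt.exists_eval_eq (F.quot_leadWeight_mapsTo_blowUp (F.chart_mapsTo b hu))
  have hnhds := (F.isOpen_chartDom b).mem_nhds hu
  have hq := (F.hasFDerivAt_faceChart b hu).continuousAt
  have hd : ContinuousAt (fun u => quotDeriv (leadWeight F.idx) (F.chart b u)) u :=
    (F.continuousOn_quotDeriv_chart b hm).continuousAt hnhds
  have hη' : ContinuousAt (fun u => η (quot (leadWeight F.idx) (F.chart b u))) u :=
    ContinuousAt.comp (g := η) (hη.continuousAt (hU.mem_nhds hxU)) hq
  have hc : ContinuousAt (fun u => η (quot (leadWeight F.idx) (F.chart b u))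
      fun a => quotDeriv (leadWeight F.idx) (F.chart b u) (b a)) u :=
    hη'.eval (continuousAt_pi.2 fun a => hd.clm_apply continuousAt_const)
  refine hc.congr ?_
  filter_upwards [hnhds, hq.eventually (hU.mem_nhds hxU)] with u' hu' hU'
  exact (hev _ (F.quot_leadWeight_mapsTo_blowUp (F.chart_mapsTo b hu')) hU' _
    fun a => F.quotDeriv_mem_tangentSpan b hu' a).symm

/-- The coefficient need not be bounded, but it is dominated by the integrable minors of the
derivative of the chart of the face. -/
theorem Flag.integrableOn_faceCoeff {ψt : FormOn k (blowUp V)} (hψt : SmoothForm ψt) :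
    IntegrableOn (F.faceCoeff b ψt) (F.chartDom b) := by
  have hmeas := (F.isOpen_chartDom b).measurableSet
  have hm := isWeight_leadWeight F.idx
  obtain ⟨C, hC⟩ := hψt.exists_bound isCompact_blowUp
  set e : Module.Basis (Σ K : Face V, K.1) ℝ (Ambient V) :=
    Pi.basis fun K : Face V => Pi.basisFun ℝ K.1 with he
  obtain ⟨B, hB, hBη⟩ := abs_continuousAlternatingMap_le_sum_det (k := k) e
  have hint : IntegrableOn (fun u => B * C * ∑ α : Fin k → Σ K : Face V, K.1,
      |(F.coordDeriv b (leadWeight F.idx) α u).det|) (F.chartDom b) :=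
    (integrable_finsetSum _ fun α _ =>
      (F.integrableOn_det_coordDeriv b α hm).abs).const_mul _
  refine hint.mono' ((F.continuousOn_faceCoeff b hψt).aestronglyMeasurable hmeas) ?_
  refine (ae_restrict_iff' hmeas).2 (Eventually.of_forall fun u hu => ?_)
  obtain ⟨η, hη, hev⟩ := hC _ (F.quot_leadWeight_mapsTo_blowUp (F.chart_mapsTo b hu))
  rw [Real.norm_eq_abs, Flag.faceCoeff, hev _ fun a => F.quotDeriv_mem_tangentSpan b hu a]
  refine (hBη η _).trans ?_
  have hrepr : ∀ α : Fin k → Σ K : Face V, K.1,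
      (Matrix.of fun a c => e.repr (quotDeriv (leadWeight F.idx) (F.chart b u) (b a)) (α c)).det
        = (F.coordDeriv b (leadWeight F.idx) α u).det := fun α => by
    simp only [F.det_coordDeriv, he, Pi.basis_repr, Pi.basisFun_repr]
  simp only [hrepr]
  gcongr

end Coefficient

end BlowUp

end

theorem mainTheorem4 {V : Type*} [Fintype V] [DecidableEq V] (k r : ℕ)
    (hcard : Fintype.card V = k + r + 1) (F : BlowUp.Flag V r)
    (b : Module.Basis (Fin k) ℝ F.angularDir)
    (ψt : BlowUp.FormOn k (BlowUp.blowUp V)) (hψt : BlowUp.SmoothForm ψt) :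
    ∃ a : ℝ, F.HasDegreeOfFreedom b (BlowUp.pushToSimplex ψt) a ∧
      BlowUp.HasFormIntegral F.blowUpFace (F.FacePos b)
        (BlowUp.FormOn.restrict F.blowUpFace_subset ψt) a := by
  have hmeas := (F.isOpen_chartDom b).measurableSet
  have hint := F.integrableOn_faceCoeff b hψt
  have hL : EqOn ((F.angularParam b).coeff (F.limitForm ψt)) (F.faceCoeff b ψt) (F.chartDom b) :=
    fun u hu => F.angularParam_coeff b ψt hu
  have hR : EqOn ((F.faceParam b).coeff (ψt.restrict F.blowUpFace_subset)) (F.faceCoeff b ψt)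
      (F.chartDom b) := fun u hu => F.faceParam_coeff b ψt hu
  exact ⟨∫ u in F.chartDom b, F.faceCoeff b ψt u,
    ⟨F.limitForm ψt, F.hasIteratedLimit_slice hψt, F.angularParam b,
      hint.congr_fun hL.symm hmeas, setIntegral_congr_fun hmeas hL⟩,
    F.faceParam b, hint.congr_fun hR.symm hmeas, setIntegral_congr_fun hmeas hR⟩
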